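/- Call a real algebraic integer $\beta>1$ a Pisot number if all its conjugates other than $\beta$ itself have absolute value less than $1$. For $x\in\mathbb R$ let $e(x)\in[-1/2,1/2)$ be the unique number with $x-e(x)\in\mathbb Z$. A real sequence $(x_n)_{n\ge 0}$ is uniformly distributed modulo one if $$\lim_{N\to\infty}\frac1N\,\mathrm{Card}\{0\le n<N : e(x_n)\in[a,b)\}=b-a\qquad\text{for all } -\tfrac12\le a<b\le\tfrac12 .$$ In a topological space $X$, let $\boldsymbol\Sigma^0_1(X)$ be the family of open sets; for $m\ge1$ let $\boldsymbol\Pi^0_m(X)$ be the family of complements of $\boldsymbol\Sigma^0_m(X)$ sets; for $m\ge2$ let $\boldsymbol\Sigma^0_m(X)$ be the family of unions $\bigcup_{i\in\mathbb N}A_i$ where each $A_i$ belongs to $\boldsymbol\Pi^0_{l_i}(X)$ for some $1\le l_i<m$. A set $A\subseteq X$ is called $\boldsymbol\Pi^0_3(X)$-complete if $A\in\boldsymbol\Pi^0_3(X)\setminus\boldsymbol\Sigma^0_3(X)$. Let $\alpha$ be a real number such that $|\alpha|$ is a Pisot number. Then for every integer $k\ge0$ the set $$\Bigl\{(\xi_0,\dots,\xi_k)\in\mathbb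 R^{k+1} : \Bigl(\sum_{j=0}^k \xi_j n^j\alpha^n\Bigr)_{n\ge0}\text{ is uniformly distributed modulo one}\Bigr\}$$ (with the convention $0^0=1$) is $\boldsymbol\Pi^0_3(\mathbb R^{k+1})$-complete. In particular, the set of real numbers normal in base $\alpha$, that is, $\{\xi\in\mathbb R : (\xi\alpha^n)_{n\ge0}\text{ is uniformly distributed modulo one}\}$, is $\boldsymbol\Pi^0_3(\mathbb R)$-complete. -/

import Mathlib

open Filter Topology

/-- The finite levels of the Borel hierarchy of a topological space `X`: `IsSigma0 m A` says that
`A` is a `Σ⁰ₘ(X)` set. The `Σ⁰₁` sets are the open sets and, for `m > 1`, the `Σ⁰ₘ` sets are the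
countable unions of sets each of which is the complement of a `Σ⁰ₗ` set (that is, a `Π⁰ₗ` set) for
some `1 ≤ l < m`. No set has level `0`, so the second constructor applies only to `m > 1`. -/
inductive IsSigma0 {X : Type*} [TopologicalSpace X] : ℕ → Set X → Prop
  | of_isOpen {A : Set X} (hA : IsOpen A) : IsSigma0 1 A
  | iUnion_compl {m : ℕ} {A : ℕ → Set X} {l : ℕ → ℕ} (hl : ∀ i, l i < m)
      (hA : ∀ i, IsSigma0 (l i) (A i)) : IsSigma0 m (⋃ i, (A i)ᶜ)

/-- `A` is a `Π⁰ₘ(X)` set: its complement is `Σ⁰ₘ(X)`. -/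
def IsPi0 {X : Type*} [TopologicalSpace X] (m : ℕ) (A : Set X) : Prop :=
  IsSigma0 m Aᶜ

/-- `A` is `Π⁰ₘ(X)`-complete: it is a `Π⁰ₘ(X)` set and not a `Σ⁰ₘ(X)` set. -/
def IsPi0Complete {X : Type*} [TopologicalSpace X] (m : ℕ) (A : Set X) : Prop :=
  IsPi0 m A ∧ ¬ IsSigma0 m A

/-- A Pisot number: a real algebraic integer `β > 1` all of whose conjugates (complex roots of its
minimal polynomial), except `β` itself, have absolute value less than `1`. -/
def IsPisot (β : ℝ) : Prop :=
  1 < β ∧ IsIntegral ℤ β ∧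
    ∀ z : ℂ, Polynomial.aeval z (minpoly ℚ β) = 0 → z ≠ (β : ℂ) → ‖z‖ < 1

/-- The representative of `ξ` modulo one in `[-1/2, 1/2)`. -/
noncomputable def centeredFract (ξ : ℝ) : ℝ :=
  Int.fract (ξ + 1 / 2) - 1 / 2

/-- `centeredFract ξ` is the unique number in `[-1/2, 1/2)` that differs from `ξ` by an integer. -/
theorem centeredFract_eq_iff (ξ e : ℝ) :
    centeredFract ξ = e ↔ e ∈ Set.Ico (-1 / 2 : ℝ) (1 / 2) ∧ ∃ u : ℤ, ξ = u + e := by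
  unfold centeredFract
  rw [sub_eq_iff_eq_add, Int.fract_eq_iff]
  constructor
  · rintro ⟨h0, h1, z, hz⟩
    exact ⟨⟨by linarith, by linarith⟩, z, by linarith⟩
  · rintro ⟨⟨h0, h1⟩, z, hz⟩
    exact ⟨by linarith, by linarith, z, by linarith⟩

open Classical in
/-- The real sequence `x` is uniformly distributed modulo one. -/
def IsUniformlyDistributedModOne (x : ℕ → ℝ) : Prop :=
  ∀ a b : ℝ, -1 / 2 ≤ a → a < b → b ≤ 1 / 2 →
    Tendsto
      (fun N : ℕ =>
        (((Finset.range N).filter (fun n => centeredFract (x n) ∈ Set.Ico a b)).card : ℝ) / N)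
      atTop (𝓝 (b - a))

/-- The set of real numbers that are normal in base `α`. -/
def normalNumbers (α : ℝ) : Set ℝ :=
  {ξ : ℝ | IsUniformlyDistributedModOne (fun n : ℕ => ξ * α ^ n)}

/-! ### The finite levels of the Borel hierarchy -/

/-! Upper bound: uniform distribution is equivalent to every open arc being visited with upper
frequency at most its length. Countably many arcs and precisions suffice, and each bound "for all `N
≥ M`" is a closed condition on the parameters (`isClosed_setOf_countBelow_le`), so a countable
intersection of countable unions of closed sets results.

Lower bound: the set of `y : ℕ → ℕ` tending to infinity is not a countable union of Gδ sets
(`setOf_tendsto_atTop_ne_iUnion_isGδ`), so it suffices to reduce it continuously to the normal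
numbers. Take a normal `ξ`, expand it in base `α` with bounded integer digits, and erase the digits
in the last `1 / (y i + 1)` of each dyadic block. Because powers of `α` are exponentially close to
integers, `ξ * α ^ n` modulo one depends, up to a small error, only on the digits near place `n`
(`exists_abs_tsum_mul_pow_sub_lt`). If `y` tends to infinity, the erased places have density zero
and normality survives. Otherwise infinitely many blocks end in a run of zeros of proportional
length, where the orbit stays near the integers, and uniform distribution fails.

A normal `ξ` exists because almost every real is one: a second moment estimate for exponential sums,
combined with Weyl's criterion. For general `k`, the same reduction is placed in the coordinate `ξ
0`. -/

theorem IsSigma0.preimage {X Y : Type*} [TopologicalSpace X] [TopologicalSpace Y] {f : X → Y}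
    (hf : Continuous f) {m : ℕ} {A : Set Y} (hA : IsSigma0 m A) : IsSigma0 m (f ⁻¹' A) := by
  induction hA with
  | of_isOpen hA => exact .of_isOpen (hA.preimage hf)
  | iUnion_compl hl _ ih =>
    rw [Set.preimage_iUnion]
    exact .iUnion_compl hl ih

theorem IsPi0.preimage {X Y : Type*} [TopologicalSpace X] [TopologicalSpace Y] {f : X → Y}
    (hf : Continuous f) {m : ℕ} {A : Set Y} (hA : IsPi0 m A) : IsPi0 m (f ⁻¹' A) :=
  IsSigma0.preimage hf hA

theorem IsSigma0.ne_zero {X : Type*} [TopologicalSpace X] {m : ℕ} {A : Set X}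
    (hA : IsSigma0 m A) : m ≠ 0 := by
  cases hA with
  | of_isOpen _ => simp
  | iUnion_compl hl _ => exact fun h => by have := hl 0; omega

theorem IsSigma0.isOpen {X : Type*} [TopologicalSpace X] {A : Set X}
    (hA : IsSigma0 1 A) : IsOpen A := by
  cases hA with
  | of_isOpen h => exact h
  | iUnion_compl hl h => exact absurd (Nat.lt_one_iff.mp (hl 0)) (h 0).ne_zero

theorem IsSigma0.isGδ_compl {X : Type*} [TopologicalSpace X]
    [TopologicalSpace.PseudoMetrizableSpace X] {m : ℕ} {A : Set X} (hA : IsSigma0 m A)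
    (hm : m < 3) : IsGδ Aᶜ := by
  let := TopologicalSpace.pseudoMetrizableSpacePseudoMetric X
  cases hA with
  | of_isOpen h => exact h.isClosed_compl.isGδ
  | @iUnion_compl _ A l hl h =>
    rw [Set.compl_iUnion]
    refine IsGδ.iInter_of_isOpen fun i => ?_
    rw [compl_compl]
    have h1 : l i = 1 := by
      have := hl i
      have := (h i).ne_zero
      omega
    have h2 := h i
    rw [h1] at h2
    exact h2.isOpen

/-- In a metrizable space, a `Σ⁰₃` set is a countable union of `Gδ` sets. -/
theorem IsSigma0.exists_iUnion_isGδ {X : Type*} [TopologicalSpace X]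
    [TopologicalSpace.PseudoMetrizableSpace X] {A : Set X} (hA : IsSigma0 3 A) :
    ∃ G : ℕ → Set X, (∀ i, IsGδ (G i)) ∧ A = ⋃ i, G i := by
  cases hA with
  | iUnion_compl hl h => exact ⟨_, fun i => (h i).isGδ_compl (hl i), rfl⟩

theorem IsPi0.of_iInter_iUnion_isClosed {X ι : Type*} [TopologicalSpace X] [Countable ι]
    [Nonempty ι] {F : ι → ℕ → Set X} (hF : ∀ i j, IsClosed (F i j)) :
    IsPi0 3 (⋂ i, ⋃ j, F i j) := by
  obtain ⟨e, he⟩ := exists_surjective_nat ι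
  have h : (⋂ i, ⋃ j, F i j)ᶜ = ⋃ n, (⋃ j, ((F (e n) j)ᶜ)ᶜ)ᶜ := by
    simp only [compl_compl, Set.compl_iInter]
    exact (he.iUnion_comp (fun i => (⋃ j, F i j)ᶜ)).symm
  rw [IsPi0, h]
  refine .iUnion_compl (l := fun _ => 2) (fun _ => by norm_num) fun n => ?_
  exact .iUnion_compl (l := fun _ => 1) (fun _ => by norm_num) fun j =>
    .of_isOpen (hF _ _).isOpen_compl

/-! ### The set of sequences of natural numbers that tend to infinity -/

/-- Baire category: a cylinder fixes finitely many coordinates, so the sequences vanishing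
infinitely often form a dense Gδ set, which meets every other dense Gδ set. -/
theorem exists_frequently_eq_zero_of_dense_isGδ {H : Set (ℕ → ℕ)} (hG : IsGδ H) (hd : Dense H) :
    ∃ y ∈ H, ∃ᶠ i in atTop, y i = 0 := by
  have ho : ∀ m : ℕ, IsOpen {y : ℕ → ℕ | ∃ i ≥ m, y i = 0} := fun m => by
    have : {y : ℕ → ℕ | ∃ i ≥ m, y i = 0} = ⋃ i ≥ m, (fun y : ℕ → ℕ => y i) ⁻¹' {0} := by
      ext; simp
    rw [this]
    exact isOpen_biUnion fun i _ => (isOpen_discrete _).preimage (continuous_apply i)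
  have hdm : ∀ m : ℕ, Dense {y : ℕ → ℕ | ∃ i ≥ m, y i = 0} := fun m => by
    refine (PiNat.isTopologicalBasis_cylinders (fun _ : ℕ => ℕ)).dense_iff.2 ?_
    rintro _ ⟨x, n, rfl⟩ -
    refine ⟨fun i => if i < n then x i else 0, ?_, max m n, le_max_left _ _, by simp⟩
    rw [PiNat.mem_cylinder_iff]
    intro i hi
    simp [hi]
  have h1 := dense_iInter_of_isOpen_nat ho hdm
  have h2 := hd.inter_of_Gδ hG (IsGδ.iInter_of_isOpen ho) h1
  obtain ⟨y, hy, hy'⟩ := h2.nonempty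
  exact ⟨y, hy, frequently_atTop.2 fun m => Set.mem_iInter.1 hy' m⟩

/-- The sequences that agree with `s` below `n` and are at least `k` from `n` on. -/
def tailAtLeast (s : ℕ → ℕ) (n k : ℕ) : Set (ℕ → ℕ) :=
  {y | (∀ i < n, y i = s i) ∧ ∀ i ≥ n, k ≤ y i}

/-- The map `φ` parametrizes `tailAtLeast s n k` by Baire space. Were `φ ⁻¹' G` dense, it would
contain a sequence with infinitely many zeros, whose image takes the value `k` infinitely often and
so cannot tend to infinity. Hence `φ ⁻¹' G` misses a cylinder. -/
theorem exists_tailAtLeast_disjoint {G : Set (ℕ → ℕ)} (hG : IsGδ G)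
    (hGt : ∀ y ∈ G, Tendsto y atTop atTop) (s : ℕ → ℕ) (n k : ℕ) :
    ∃ s' n', n < n' ∧ s' ∈ tailAtLeast s n k ∧
      ∀ y ∈ tailAtLeast s n k, (∀ i < n', y i = s' i) → y ∉ G := by
  set φ : (ℕ → ℕ) → ℕ → ℕ := fun z i => if i < n then s i else k + z i with hφ
  have hφc : Continuous φ := by
    refine continuous_pi fun i => ?_
    by_cases hi : i < n
    · simpa [hφ, hi] using continuous_const
    · simp only [hφ, hi, if_false]
      exact continuous_const.add (continuous_apply i)
  have hφm : ∀ z, φ z ∈ tailAtLeast s n k := fun z =>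
    ⟨fun i hi => by simp [hφ, hi], fun i hi => by simp [hφ, not_lt.2 hi]⟩
  have hφs : ∀ y ∈ tailAtLeast s n k, φ (fun i => y i - k) = y := fun y hy => by
    ext i
    by_cases hi : i < n
    · simp [hφ, hi, hy.1 i hi]
    · have := hy.2 i (not_lt.1 hi)
      simp only [hφ, hi, if_false]
      omega
  have hnd : ¬ Dense (φ ⁻¹' G) := fun hd => by
    obtain ⟨y, hy, hfr⟩ := exists_frequently_eq_zero_of_dense_isGδ (hG.preimage hφc) hd
    have h1 := (hGt _ hy).eventually_gt_atTop k
    obtain ⟨i, hi, hi', hi''⟩ := (hfr.and_eventually (h1.and (eventually_ge_atTop n))).exists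
    simp [hφ, not_lt.2 hi'', hi] at hi'
  rw [(PiNat.isTopologicalBasis_cylinders (fun _ : ℕ => ℕ)).dense_iff] at hnd
  push Not at hnd
  obtain ⟨_, ⟨x, m, rfl⟩, -, he⟩ := hnd
  refine ⟨φ x, max (n + 1) m, by simp, hφm x, fun y hy hyx hyG => ?_⟩
  -- `φ` ignores the coordinates below `n`, so they may be taken from `x`; this puts the preimage of
  -- `y` in the cylinder of `x`.
  have h2 : φ (fun i => if i < n then x i else y i - k) = y := by
    rw [← hφs y hy]
    ext i
    by_cases hi : i < n <;> simp [hφ, hi]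
  refine Set.eq_empty_iff_forall_notMem.1 he (fun i => if i < n then x i else y i - k) ⟨?_, ?_⟩
  · rw [PiNat.mem_cylinder_iff]
    intro i hi
    by_cases hin : i < n
    · simp [hin]
    · have := hyx i (lt_of_lt_of_le hi (le_max_right _ _))
      simp [hφ, hin] at this
      simp [hin, this]
  · rw [Set.mem_preimage, h2]
    exact hyG

/-- A fusion argument: stage `k` extends the current prefix so as to leave `G k` among sequences
whose later values are at least `k`, and then the lower bound is raised to `k + 1`. The limit of the
prefixes tends to infinity but lies in no `G k`. -/
theorem setOf_tendsto_atTop_ne_iUnion_isGδ {G : ℕ → Set (ℕ → ℕ)} (hG : ∀ k, IsGδ (G k)) :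
    {y : ℕ → ℕ | Tendsto y atTop atTop} ≠ ⋃ k, G k := by
  intro hU
  have hGt : ∀ k, ∀ y ∈ G k, Tendsto y atTop atTop := fun k y hy =>
    hU.symm.subset (Set.mem_iUnion_of_mem k hy)
  choose S N hN hS hd using fun (p : (ℕ → ℕ) × ℕ) (k : ℕ) =>
    exists_tailAtLeast_disjoint (hG k) (hGt k) p.1 p.2 k
  let p : ℕ → (ℕ → ℕ) × ℕ := fun k => Nat.rec (0, 0) (fun k q => (S q k, N q k)) k
  have hp : ∀ k, p (k + 1) = (S (p k) k, N (p k) k) := fun k => rfl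
  have hmono : StrictMono fun k => (p k).2 := strictMono_nat_of_lt_succ fun k => by
    simpa [hp] using hN (p k) k
  have hmem : ∀ k j, (p (k + 1 + j)).1 ∈ tailAtLeast (p k).1 (p k).2 k := by
    intro k j
    induction j generalizing k with
    | zero => simpa [hp] using hS (p k) k
    | succ j ih =>
      have h1 := ih (k + 1)
      rw [show k + 1 + 1 + j = k + 1 + (j + 1) by ring] at h1
      have h0 : (p (k + 1)).1 ∈ tailAtLeast (p k).1 (p k).2 k := by simpa [hp] using hS (p k) k
      have hlt : (p k).2 < (p (k + 1)).2 := hmono (Nat.lt_succ_self k)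
      refine ⟨fun i hi => (h1.1 i (hi.trans hlt)).trans (h0.1 i hi), fun i hi => ?_⟩
      rcases lt_or_ge i (p (k + 1)).2 with h | h
      · rw [h1.1 i h]
        exact h0.2 i hi
      · exact (Nat.le_succ k).trans (h1.2 i h)
  -- Prefix lengths increase strictly, so the prefix of stage `i + 1` has length at least `i + 1`
  -- and already fixes coordinate `i`.
  let y : ℕ → ℕ := fun i => (p (i + 1)).1 i
  have hy : ∀ k i, i < (p k).2 → y i = (p k).1 i := by
    intro k i h
    rcases lt_or_ge i k with hik | hik
    · obtain ⟨j, rfl⟩ := Nat.exists_eq_add_of_lt hik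
      rcases j with _ | j
      · rfl
      · have h2 := (hmem (i + 1) j).1 i (hmono.le_apply (x := i + 1))
        rw [show i + (j + 1) + 1 = i + 1 + 1 + j by ring]
        exact h2.symm
    · obtain ⟨j, rfl⟩ := Nat.exists_eq_add_of_le hik
      have h2 := (hmem k j).1 _ h
      rwa [show k + 1 + j = k + j + 1 by ring] at h2
  have hyk : ∀ k, y ∈ tailAtLeast (p k).1 (p k).2 k := by
    intro k
    refine ⟨hy k, fun i hi => ?_⟩
    · have hki : k ≤ i := hmono.le_apply.trans hi
      obtain ⟨j, rfl⟩ := Nat.exists_eq_add_of_le hki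
      have := (hmem k j).2 _ hi
      rwa [show k + 1 + j = k + j + 1 by ring] at this
  have hyt : Tendsto y atTop atTop := tendsto_atTop.2 fun k =>
    (eventually_ge_atTop (p k).2).mono (hyk k).2
  have : y ∈ ⋃ k, G k := hU.subset hyt
  obtain ⟨k, hk⟩ := Set.mem_iUnion.1 this
  refine hd (p k) k y (hyk k) (fun i hi => ?_) hk
  exact (hyk (k + 1)).1 i hi

/-- A set `A` is not `Σ⁰₃` if the set of sequences tending to infinity is a continuous preimage
of `A`. -/
theorem not_isSigma0_three_of_continuous {X : Type*} [TopologicalSpace X] {A : Set X}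
    {f : (ℕ → ℕ) → X} (hf : Continuous f) (hfA : ∀ y, f y ∈ A ↔ Tendsto y atTop atTop) :
    ¬ IsSigma0 3 A := by
  intro hA
  obtain ⟨G, hG, hU⟩ := (hA.preimage hf).exists_iUnion_isGδ
  refine setOf_tendsto_atTop_ne_iUnion_isGδ hG ?_
  rw [← hU]
  ext y
  exact (hfA y).symm

/-! ### Uniform distribution in terms of open arcs -/

/-- The real numbers whose class modulo one meets the open interval `(a, b)`. -/
def openArc (a b : ℝ) : Set ℝ :=
  {t | ∃ m : ℤ, a < t - m ∧ t - m < b}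

open Classical in
/-- The number of `n < N` that belong to `A`. -/
noncomputable def countBelow (A : Set ℕ) (N : ℕ) : ℕ :=
  ((Finset.range N).filter (· ∈ A)).card

theorem countBelow_setOf (p : ℕ → Prop) [DecidablePred p] (N : ℕ) :
    countBelow {n | p n} N = ((Finset.range N).filter p).card := by
  unfold countBelow
  congr 1
  ext n
  simp

theorem countBelow_le (A : Set ℕ) (N : ℕ) : countBelow A N ≤ N := by
  classical
  simpa only [countBelow, Finset.card_range] using Finset.card_filter_le (Finset.range N) _

theorem countBelow_mono {A B : Set ℕ} (h : A ⊆ B) (N : ℕ) : countBelow A N ≤ countBelow B N :=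
  Finset.card_le_card fun n hn => by
    simp only [Finset.mem_filter] at hn ⊢
    exact ⟨hn.1, h hn.2⟩

theorem countBelow_union_le (A B : Set ℕ) (N : ℕ) :
    countBelow (A ∪ B) N ≤ countBelow A N + countBelow B N := by
  classical
  refine le_trans (Finset.card_le_card fun n hn => ?_) (Finset.card_union_le _ _)
  simp only [Finset.mem_filter, Finset.mem_union, Set.mem_union] at hn ⊢
  tauto

theorem countBelow_add_compl (A : Set ℕ) (N : ℕ) : countBelow A N + countBelow Aᶜ N = N := by
  classical
  simpa [countBelow] using Finset.card_filter_add_card_filter_not (s := Finset.range N) (· ∈ A)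

theorem isOpen_openArc (a b : ℝ) : IsOpen (openArc a b) := by
  have : openArc a b = ⋃ m : ℤ, (fun t : ℝ => t - m) ⁻¹' Set.Ioo a b := by
    ext t
    simp only [openArc, Set.mem_ofPred_eq, Set.mem_iUnion, Set.mem_preimage, Set.mem_Ioo]
  rw [this]
  exact isOpen_iUnion fun m => isOpen_Ioo.preimage (by fun_prop)

theorem openArc_sub_intCast (a b : ℝ) (m : ℤ) : openArc (a - m) (b - m) = openArc a b := by
  ext t
  constructor
  · rintro ⟨u, h1, h2⟩
    exact ⟨u - m, by push_cast; linarith, by push_cast; linarith⟩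
  · rintro ⟨u, h1, h2⟩
    exact ⟨u + m, by push_cast; linarith, by push_cast; linarith⟩

theorem centeredFract_mem_Ico (t : ℝ) : centeredFract t ∈ Set.Ico (-1 / 2 : ℝ) (1 / 2) :=
  ((centeredFract_eq_iff t _).1 rfl).1

theorem exists_sub_intCast_eq_centeredFract (t : ℝ) : ∃ m : ℤ, t - m = centeredFract t := by
  obtain ⟨m, hm⟩ := ((centeredFract_eq_iff t _).1 rfl).2
  exact ⟨m, by linarith⟩

theorem centeredFract_eq_sub_intCast {t : ℝ} {m : ℤ} (h0 : -1 / 2 ≤ t - m) (h1 : t - m < 1 / 2) :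
    centeredFract t = t - m :=
  (centeredFract_eq_iff t _).2 ⟨⟨h0, h1⟩, m, by ring⟩

/-- Every open arc is visited with upper frequency at most its length. -/
def HasArcBounds (x : ℕ → ℝ) : Prop :=
  ∀ a b : ℝ, a < b → ∀ ε > 0, ∀ᶠ N : ℕ in atTop,
    (countBelow {n | x n ∈ openArc a b} N : ℝ) ≤ (b - a + ε) * N

theorem isUniformlyDistributedModOne_iff (x : ℕ → ℝ) :
    IsUniformlyDistributedModOne x ↔ ∀ a b : ℝ, -1 / 2 ≤ a → a < b → b ≤ 1 / 2 →
      Tendsto (fun N : ℕ => (countBelow {n | centeredFract (x n) ∈ Set.Ico a b} N : ℝ) / N)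
        atTop (𝓝 (b - a)) := by
  simp only [IsUniformlyDistributedModOne, countBelow_setOf]

theorem eventually_countBelow_le_of_tendsto {A : Set ℕ} {c d : ℝ}
    (h : Tendsto (fun N : ℕ => (countBelow A N : ℝ) / N) atTop (𝓝 c)) (hcd : c < d) :
    ∀ᶠ N : ℕ in atTop, (countBelow A N : ℝ) ≤ d * N := by
  filter_upwards [h.eventually_lt_const hcd, eventually_gt_atTop 0] with N h1 h2
  have : (0 : ℝ) < N := by exact_mod_cast h2
  exact ((div_lt_iff₀ this).1 h1).le

/-- The arc either stays inside `[-1/2, 1/2)` or wraps past `1/2` once, in which case it is covered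
by two half-open intervals of the same total length. -/
theorem IsUniformlyDistributedModOne.eventually_countBelow_openArc_le {x : ℕ → ℝ}
    (hx : IsUniformlyDistributedModOne x) {a b ε : ℝ} (ha0 : -1 / 2 ≤ a) (ha1 : a < 1 / 2)
    (hab : a < b) (hb : b - a < 1) (hε : 0 < ε) :
    ∀ᶠ N : ℕ in atTop, (countBelow {n | x n ∈ openArc a b} N : ℝ) ≤ (b - a + ε) * N := by
  rw [isUniformlyDistributedModOne_iff] at hx
  have key : ∀ t ∈ openArc a b, centeredFract t ∈ Set.Ico a b ∩ Set.Iio (1 / 2) ∨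
      1 / 2 < b ∧ centeredFract t ∈ Set.Ico (-1 / 2) (b - 1) := by
    rintro t ⟨m, h1, h2⟩
    rcases lt_or_ge (t - m) (1 / 2) with h | h
    · rw [centeredFract_eq_sub_intCast (by linarith) h]
      exact Or.inl ⟨⟨h1.le, h2⟩, h⟩
    · have : centeredFract t = t - (m + 1 : ℤ) :=
        centeredFract_eq_sub_intCast (by push_cast; linarith) (by push_cast; linarith)
      rw [this]
      push_cast
      exact Or.inr ⟨by linarith, by linarith, by linarith⟩
  rcases le_or_gt b (1 / 2) with hb2 | hb2
  · refine (eventually_countBelow_le_of_tendsto (hx a b ha0 hab hb2)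
      (show b - a < b - a + ε by linarith)).mono fun N hN => le_trans ?_ hN
    refine Nat.cast_le.2 (countBelow_mono (fun n hn => ?_) N)
    rcases key _ hn with h | h
    · exact h.1
    · linarith [h.1]
  · have h1 := eventually_countBelow_le_of_tendsto (hx a (1 / 2) ha0 ha1 le_rfl)
      (show 1 / 2 - a < 1 / 2 - a + ε / 2 by linarith)
    have h2 := eventually_countBelow_le_of_tendsto
      (hx (-1 / 2) (b - 1) le_rfl (by linarith) (by linarith))
      (show b - 1 - -1 / 2 < b - 1 - -1 / 2 + ε / 2 by linarith)
    filter_upwards [h1, h2] with N h1 h2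
    have h3 : countBelow {n | x n ∈ openArc a b} N ≤
        countBelow {n | centeredFract (x n) ∈ Set.Ico a (1 / 2)} N +
        countBelow {n | centeredFract (x n) ∈ Set.Ico (-1 / 2) (b - 1)} N := by
      refine (countBelow_mono (fun n hn => ?_) N).trans (countBelow_union_le _ _ _)
      rcases key _ hn with h | h
      · exact Or.inl ⟨h.1.1, h.2⟩
      · exact Or.inr h.2
    have h4 : (countBelow {n | x n ∈ openArc a b} N : ℝ) ≤
        countBelow {n | centeredFract (x n) ∈ Set.Ico a (1 / 2)} N +
        countBelow {n | centeredFract (x n) ∈ Set.Ico (-1 / 2) (b - 1)} N := by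
      exact_mod_cast h3
    linarith

theorem IsUniformlyDistributedModOne.hasArcBounds {x : ℕ → ℝ}
    (hx : IsUniformlyDistributedModOne x) : HasArcBounds x := by
  intro a b hab ε hε
  rcases le_or_gt 1 (b - a) with h1 | h1
  · refine Eventually.of_forall fun N => ?_
    have h2 : (countBelow {n | x n ∈ openArc a b} N : ℝ) ≤ N := by
      exact_mod_cast countBelow_le _ _
    nlinarith [(Nat.cast_nonneg N : (0 : ℝ) ≤ N)]
  obtain ⟨m, hm⟩ := exists_sub_intCast_eq_centeredFract a
  obtain ⟨ha0, ha1⟩ := centeredFract_mem_Ico a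
  rw [← hm] at ha0 ha1
  rw [← openArc_sub_intCast a b m, show b - a = (b - m) - (a - m) by ring]
  exact hx.eventually_countBelow_openArc_le ha0 ha1 (by linarith) (by linarith) hε

/-- Upper bounds alone suffice, since an upper bound for the complementary arc from `b` to `a + 1`
is a lower bound for `[a, b)`. Moving the left endpoints by `ε / 4` makes the half-open intervals
fit in open arcs. -/
theorem HasArcBounds.isUniformlyDistributedModOne {x : ℕ → ℝ} (hx : HasArcBounds x) :
    IsUniformlyDistributedModOne x := by
  rw [isUniformlyDistributedModOne_iff]
  intro a b ha hab hb
  rw [Metric.tendsto_atTop']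
  intro ε hε
  have h1 := hx (a - ε / 4) b (by linarith) (ε / 4) (by linarith)
  have h2 := hx (b - ε / 4) (a + 1) (by linarith) (ε / 4) (by linarith)
  obtain ⟨M, hM⟩ := eventually_atTop.1 (h1.and (h2.and (eventually_gt_atTop 0)))
  refine ⟨M, fun N hN => ?_⟩
  obtain ⟨h1, h2, h3⟩ := hM N hN.le
  have hN0 : (0 : ℝ) < N := by exact_mod_cast h3
  set A : Set ℕ := {n | centeredFract (x n) ∈ Set.Ico a b}
  have h4 : countBelow A N ≤ countBelow {n | x n ∈ openArc (a - ε / 4) b} N :=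
    countBelow_mono (fun n hn => by
      obtain ⟨m, hm⟩ := exists_sub_intCast_eq_centeredFract (x n)
      refine ⟨m, ?_, ?_⟩ <;> rw [hm] <;> linarith [hn.1, hn.2]) N
  have h5 : countBelow Aᶜ N ≤ countBelow {n | x n ∈ openArc (b - ε / 4) (a + 1)} N :=
    countBelow_mono (fun n hn => by
      obtain ⟨m, hm⟩ := exists_sub_intCast_eq_centeredFract (x n)
      obtain ⟨h0, h1⟩ := centeredFract_mem_Ico (x n)
      rcases lt_or_ge (centeredFract (x n)) a with h | h
      · exact ⟨m - 1, by push_cast; linarith, by push_cast; linarith⟩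
      · have h6 : b ≤ centeredFract (x n) := not_lt.1 fun h' => hn ⟨h, h'⟩
        exact ⟨m, by linarith, by linarith⟩) N
  have h6 : (countBelow A N : ℝ) + countBelow Aᶜ N = N := by
    exact_mod_cast countBelow_add_compl A N
  have h4' : (countBelow A N : ℝ) ≤ (b - (a - ε / 4) + ε / 4) * N :=
    le_trans (by exact_mod_cast h4) h1
  have h5' : (countBelow Aᶜ N : ℝ) ≤ (a + 1 - (b - ε / 4) + ε / 4) * N :=
    le_trans (by exact_mod_cast h5) h2
  have h7 : 0 < ε * N := by positivity
  rw [Real.dist_eq, abs_lt]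
  constructor
  · rw [neg_lt_sub_iff_lt_add, ← sub_lt_iff_lt_add', lt_div_iff₀ hN0]
    nlinarith
  · rw [sub_lt_iff_lt_add, div_lt_iff₀ hN0]
    nlinarith

/-- Rational arcs and rational precision suffice in `HasArcBounds`. -/
theorem hasArcBounds_iff_rat (x : ℕ → ℝ) :
    HasArcBounds x ↔ ∀ p : ℚ × ℚ × ℕ, ∃ M : ℕ, ∀ N ≥ M,
      (countBelow {n | x n ∈ openArc p.1 p.2.1} N : ℝ) ≤
        (max (p.2.1 - p.1 : ℝ) 0 + 1 / (p.2.2 + 1)) * N := by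
  constructor
  · rintro hx ⟨a, b, k⟩
    have hk : (0 : ℝ) < 1 / (k + 1) := by positivity
    rcases lt_or_ge (a : ℝ) b with h | h
    · rw [max_eq_left (by simpa using h.le)]
      exact eventually_atTop.1 (hx a b h _ hk)
    -- Here the arc is empty; the `max` with `0` keeps the right side nonnegative.
    · refine ⟨0, fun N _ => ?_⟩
      have : {n | x n ∈ openArc a b} = ∅ := by
        ext n
        simp only [Set.mem_ofPred_eq, Set.mem_empty_iff_false, iff_false]
        rintro ⟨m, h1, h2⟩
        linarith
      simp only [this]
      simp only [countBelow, Set.mem_empty_iff_false, Finset.filter_false, Finset.card_empty,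
        Nat.cast_zero]
      positivity
  · intro H a b hab ε hε
    obtain ⟨k, hk⟩ := exists_nat_one_div_lt (show 0 < ε / 3 by linarith)
    obtain ⟨a', ha1, ha2⟩ := exists_rat_btwn (show a - ε / 3 < a by linarith)
    obtain ⟨b', hb1, hb2⟩ := exists_rat_btwn (show b < b + ε / 3 by linarith)
    obtain ⟨M, hM⟩ := H (a', b', k)
    refine eventually_atTop.2 ⟨M, fun N hN => ?_⟩
    have h1 : countBelow {n | x n ∈ openArc a b} N ≤ countBelow {n | x n ∈ openArc a' b'} N :=
      countBelow_mono (fun n hn => by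
        obtain ⟨m, hm1, hm2⟩ := hn
        exact ⟨m, by linarith, by linarith⟩) N
    refine (Nat.cast_le.2 h1).trans ((hM N hN).trans ?_)
    refine mul_le_mul_of_nonneg_right ?_ (Nat.cast_nonneg N)
    rw [max_eq_left (by simp only; linarith)]
    simp only
    linarith

/-- A count exceeding `c` is witnessed by a finite set of indices `n` with `x n ξ ∈ U`, and this is
an open condition on `ξ`. -/
theorem isClosed_setOf_countBelow_le {X : Type*} [TopologicalSpace X] {x : ℕ → X → ℝ}
    (hx : ∀ n, Continuous (x n)) {U : Set ℝ} (hU : IsOpen U) (N : ℕ) (c : ℝ) :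
    IsClosed {ξ | (countBelow {n | x n ξ ∈ U} N : ℝ) ≤ c} := by
  have h : {ξ | (countBelow {n | x n ξ ∈ U} N : ℝ) ≤ c}ᶜ =
      ⋃ T ∈ {T : Finset ℕ | T ⊆ Finset.range N ∧ c < T.card}, ⋂ n ∈ T, x n ⁻¹' U := by
    classical
    ext ξ
    simp only [Set.mem_compl_iff, Set.mem_ofPred_eq, not_le, Set.mem_iUnion, Set.mem_iInter,
      Set.mem_preimage, exists_prop]
    constructor
    · intro h
      exact ⟨(Finset.range N).filter (fun n => x n ξ ∈ U), ⟨Finset.filter_subset _ _,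
        by rwa [countBelow_setOf] at h⟩, fun n hn => (Finset.mem_filter.1 hn).2⟩
    · rintro ⟨T, ⟨hT, hc⟩, h⟩
      refine hc.trans_le (Nat.cast_le.2 (Finset.card_le_card fun n hn => ?_))
      exact Finset.mem_filter.2 ⟨hT hn, h n hn⟩
  rw [← isOpen_compl_iff, h]
  exact isOpen_biUnion fun T _ => isOpen_biInter_finset fun n _ => hU.preimage (hx n)

/-- The parameters for which a sequence of continuous functions is uniformly distributed modulo
one form a `Π⁰₃` set. -/
theorem isPi0_three_setOf_isUniformlyDistributedModOne {X : Type*} [TopologicalSpace X]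
    {x : ℕ → X → ℝ} (hx : ∀ n, Continuous (x n)) :
    IsPi0 3 {ξ | IsUniformlyDistributedModOne fun n => x n ξ} := by
  have h : {ξ | IsUniformlyDistributedModOne fun n => x n ξ} =
      ⋂ p : ℚ × ℚ × ℕ, ⋃ M : ℕ, ⋂ N ≥ M,
        {ξ | (countBelow {n | x n ξ ∈ openArc p.1 p.2.1} N : ℝ) ≤
          (max (p.2.1 - p.1 : ℝ) 0 + 1 / (p.2.2 + 1)) * N} := by
    ext ξ
    have : IsUniformlyDistributedModOne (fun n => x n ξ) ↔ HasArcBounds fun n => x n ξ :=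
      ⟨fun h => h.hasArcBounds, fun h => h.isUniformlyDistributedModOne⟩
    rw [Set.mem_ofPred_eq, this, hasArcBounds_iff_rat]
    simp only [Set.mem_iInter, Set.mem_iUnion, Set.mem_ofPred_eq]
  rw [h]
  exact IsPi0.of_iInter_iUnion_isClosed fun p M => isClosed_biInter fun N _ =>
    isClosed_setOf_countBelow_le hx (isOpen_openArc _ _) N _

/-! ### Sets of density zero -/

/-- The set `A` of natural numbers has density zero. -/
def HasZeroDensity (A : Set ℕ) : Prop :=
  ∀ ε > 0, ∀ᶠ N : ℕ in atTop, (countBelow A N : ℝ) ≤ ε * N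

theorem HasZeroDensity.mono {A B : Set ℕ} (hB : HasZeroDensity B) (h : A ⊆ B) :
    HasZeroDensity A := fun ε hε =>
  (hB ε hε).mono fun N hN => le_trans (Nat.cast_le.2 (countBelow_mono h N)) hN

/-- Outside a set of density zero, a visit of `y` to an arc is a visit of `x` to the slightly
enlarged arc. The four quarters of `ε` pay for the two endpoints, the bound for `x`, and the
exceptional set. -/
theorem HasArcBounds.congr {x y : ℕ → ℝ} (hx : HasArcBounds x)
    (hxy : ∀ ε > 0, HasZeroDensity {n | ¬ ∃ m : ℤ, |y n - x n - m| < ε}) : HasArcBounds y := by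
  intro a b hab ε hε
  have h1 := hx (a - ε / 4) (b + ε / 4) (by linarith) (ε / 4) (by linarith)
  filter_upwards [h1, hxy (ε / 4) (by linarith) (ε / 4) (by linarith)] with N h1 h2
  have h3 : countBelow {n | y n ∈ openArc a b} N ≤
      countBelow {n | x n ∈ openArc (a - ε / 4) (b + ε / 4)} N +
      countBelow {n | ¬ ∃ m : ℤ, |y n - x n - m| < ε / 4} N := by
    refine (countBelow_mono (fun n hn => ?_) N).trans (countBelow_union_le _ _ _)
    by_cases h : ∃ m : ℤ, |y n - x n - m| < ε / 4
    · obtain ⟨m, hm⟩ := h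
      obtain ⟨u, hu1, hu2⟩ := hn
      rw [abs_lt] at hm
      exact Or.inl ⟨u - m, by push_cast; linarith, by push_cast; linarith⟩
    · exact Or.inr h
  have h4 : (countBelow {n | y n ∈ openArc a b} N : ℝ) ≤
      countBelow {n | x n ∈ openArc (a - ε / 4) (b + ε / 4)} N +
      countBelow {n | ¬ ∃ m : ℤ, |y n - x n - m| < ε / 4} N := by exact_mod_cast h3
  linarith

theorem countBelow_add_le (A : Set ℕ) (M j : ℕ) : countBelow A (M + j) ≤ countBelow A M + j := by
  classical
  have h : (Finset.range (M + j)).filter (· ∈ A) ⊆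
      (Finset.range M).filter (· ∈ A) ∪ Finset.Ico M (M + j) := fun n hn => by
    simp only [Finset.mem_filter, Finset.mem_range, Finset.mem_union, Finset.mem_Ico] at hn ⊢
    by_cases h : n < M
    · exact Or.inl ⟨h, hn.2⟩
    · exact Or.inr ⟨not_lt.1 h, hn.1⟩
  refine (Finset.card_le_card h).trans ((Finset.card_union_le _ _).trans ?_)
  simp only [Nat.card_Ico, Nat.add_sub_cancel_left]
  exact le_rfl

/-- The `L`-neighbourhood of a set of density zero has density zero. -/
theorem HasZeroDensity.thickening {A : Set ℕ} (hA : HasZeroDensity A) (L : ℕ) :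
    HasZeroDensity {n | ∃ m ∈ A, n ≤ m + L ∧ m ≤ n + L} := by
  classical
  have hc : ∀ N, countBelow {n | ∃ m ∈ A, n ≤ m + L ∧ m ≤ n + L} N ≤
      (countBelow A N + L) * (2 * L + 1) := fun N => by
    have h1 : (Finset.range N).filter (· ∈ {n | ∃ m ∈ A, n ≤ m + L ∧ m ≤ n + L}) ⊆
        ((Finset.range (N + L)).filter (· ∈ A)).biUnion fun m => Finset.Icc (m - L) (m + L) := by
      intro n hn
      simp only [Finset.mem_filter, Finset.mem_range, Set.mem_ofPred_eq, Finset.mem_biUnion,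
        Finset.mem_Icc] at hn ⊢
      obtain ⟨h1, m, hm, h2, h3⟩ := hn
      exact ⟨m, ⟨by omega, hm⟩, by omega, by omega⟩
    refine (Finset.card_le_card h1).trans ((Finset.card_biUnion_le_card_mul _ _ (2 * L + 1)
      fun m _ => by rw [Nat.card_Icc]; omega).trans ?_)
    exact Nat.mul_le_mul_right _ (countBelow_add_le A N L)
  intro ε hε
  have hL : (0 : ℝ) < 2 * L + 1 := by positivity
  have h2 : ∀ᶠ N : ℕ in atTop, (L : ℝ) ≤ ε / (2 * (2 * L + 1)) * N :=
    (tendsto_natCast_atTop_atTop.const_mul_atTop (by positivity)).eventually_ge_atTop _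
  filter_upwards [hA (ε / (2 * (2 * L + 1))) (by positivity), h2] with N h1 h2
  have h3 : (countBelow {n | ∃ m ∈ A, n ≤ m + L ∧ m ≤ n + L} N : ℝ) ≤
      (countBelow A N + L) * (2 * L + 1) := by exact_mod_cast hc N
  refine h3.trans ((mul_le_mul_of_nonneg_right (add_le_add h1 h2) hL.le).trans (le_of_eq ?_))
  field_simp
  ring

/-! ### Exponential sums -/

theorem norm_sum_exp_sq (θ : ℕ → ℝ) (N : ℕ) :
    ‖∑ n ∈ Finset.range N, Complex.exp (θ n * Complex.I)‖ ^ 2 =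
      ∑ n ∈ Finset.range N, ∑ m ∈ Finset.range N, Real.cos (θ n - θ m) := by
  rw [← Complex.normSq_eq_norm_sq, Complex.normSq_apply]
  simp only [Complex.re_sum, Complex.im_sum, Complex.exp_ofReal_mul_I_re,
    Complex.exp_ofReal_mul_I_im, Finset.sum_mul_sum, ← Finset.sum_add_distrib]
  simp only [Real.cos_sub]

theorem abs_integral_cos_mul_le {c : ℝ} (hc : c ≠ 0) :
    |∫ t in (0 : ℝ)..1, Real.cos (t * c)| ≤ 1 / |c| := by
  have h := intervalIntegral.integral_comp_mul_right (f := Real.cos) (a := 0) (b := 1) hc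
  rw [h, integral_cos]
  simp only [zero_mul, Real.sin_zero, sub_zero, one_mul, smul_eq_mul, abs_mul, abs_inv]
  rw [one_div]
  exact mul_le_of_le_one_right (by positivity) (Real.abs_sin_le_one c)

/-- Expanding the square, the diagonal contributes `N`. For fixed `n`, the off-diagonal integrals
are bounded by `C * r ^ m`, a geometric series in `m`; so the second moment is linear in `N`. -/
theorem integral_norm_sum_exp_sq_le {a : ℕ → ℝ} {C r : ℝ} (hr0 : 0 ≤ r) (hr1 : r < 1)
    (hC : 0 ≤ C) (ha : ∀ n m, n ≠ m → a n ≠ a m ∧ 1 / |a n - a m| ≤ C * r ^ m) (N : ℕ) :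
    ∫ t in (0 : ℝ)..1, ‖∑ n ∈ Finset.range N, Complex.exp ((t * a n : ℝ) * Complex.I)‖ ^ 2 ≤
      (1 + C * (1 - r)⁻¹) * N := by
  have hcont : ∀ n m, Continuous fun t : ℝ => Real.cos (t * a n - t * a m) := fun n m => by fun_prop
  have h1 : ∀ n m, ∫ t in (0 : ℝ)..1, Real.cos (t * a n - t * a m) ≤
      (if n = m then 1 else 0) + C * r ^ m := fun n m => by
    by_cases h : n = m
    · subst h
      simp only [sub_self, Real.cos_zero, intervalIntegral.integral_const, if_true]
      have : 0 ≤ C * r ^ n := by positivity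
      simpa using this
    · obtain ⟨h2, h3⟩ := ha n m h
      simp only [← mul_sub, if_neg h, zero_add]
      exact (le_abs_self _).trans ((abs_integral_cos_mul_le (sub_ne_zero.2 h2)).trans h3)
  simp only [norm_sum_exp_sq]
  rw [intervalIntegral.integral_finsetSum fun n _ =>
    (continuous_finsetSum _ fun m _ => hcont n m).intervalIntegrable _ _]
  have h4 : ∀ n ∈ Finset.range N, ∫ t in (0 : ℝ)..1, ∑ m ∈ Finset.range N,
      Real.cos (t * a n - t * a m) ≤ 1 + C * (1 - r)⁻¹ := fun n hn => by
    rw [intervalIntegral.integral_finsetSum fun m _ => (hcont n m).intervalIntegrable _ _]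
    refine (Finset.sum_le_sum fun m _ => h1 n m).trans ?_
    rw [Finset.sum_add_distrib, Finset.sum_ite_eq, if_pos hn, ← Finset.mul_sum]
    gcongr
    rw [← tsum_geometric_of_lt_one hr0 hr1]
    exact (summable_geometric_of_lt_one hr0 hr1).sum_le_tsum _ fun _ _ => by positivity
  refine (Finset.sum_le_sum h4).trans (le_of_eq ?_)
  rw [Finset.sum_const, Finset.card_range, nsmul_eq_mul, mul_comm]

/-- Squares are dense enough: `N` exceeds the largest square `M ^ 2` below it by at most `2 * M`,
which is negligible against `N`. -/
theorem tendsto_norm_sum_div_of_sq {z : ℕ → ℂ} (hz : ∀ n, ‖z n‖ ≤ 1)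
    (h : Tendsto (fun M : ℕ => ‖∑ n ∈ Finset.range ((M + 1) ^ 2), z n‖ ^ 2 / ((M + 1 : ℕ) : ℝ) ^ 4)
      atTop (𝓝 0)) :
    Tendsto (fun N : ℕ => (∑ n ∈ Finset.range N, z n) / N) atTop (𝓝 0) := by
  have h1 : Tendsto (fun M : ℕ => ‖∑ n ∈ Finset.range (M ^ 2), z n‖ / (M : ℝ) ^ 2)
      atTop (𝓝 0) := by
    rw [← tendsto_add_atTop_iff_nat 1]
    have := h.sqrt
    rw [Real.sqrt_zero] at this
    refine this.congr fun M => ?_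
    rw [Real.sqrt_div (by positivity), Real.sqrt_sq (norm_nonneg _),
      show (((M + 1 : ℕ) : ℝ)) ^ 4 = (((M + 1 : ℕ) : ℝ) ^ 2) ^ 2 by ring,
      Real.sqrt_sq (by positivity)]
  have hs : Tendsto Nat.sqrt atTop atTop := tendsto_atTop.2 fun b =>
    (eventually_ge_atTop (b * b)).mono fun N hN => Nat.le_sqrt.2 hN
  have h2 : Tendsto (fun M : ℕ => 2 / (M : ℝ)) atTop (𝓝 0) := tendsto_const_div_atTop_nhds_zero_nat 2
  have h3 := (h1.comp hs).add (h2.comp hs)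
  rw [add_zero] at h3
  refine squeeze_zero_norm' ?_ h3
  filter_upwards [eventually_gt_atTop 0] with N hN
  simp only [Function.comp_apply]
  have hM0 : 0 < Nat.sqrt N := Nat.sqrt_pos.2 hN
  have hle : Nat.sqrt N ^ 2 ≤ N := Nat.sqrt_le' N
  have hlt : N ≤ Nat.sqrt N ^ 2 + 2 * Nat.sqrt N := by
    have := Nat.sqrt_le_add N
    nlinarith
  generalize Nat.sqrt N = M at *
  have hMR : (0 : ℝ) < M := by exact_mod_cast hM0
  have hNR : (0 : ℝ) < N := by exact_mod_cast hN
  have h4 : ‖∑ n ∈ Finset.range N, z n‖ ≤ ‖∑ n ∈ Finset.range (M ^ 2), z n‖ + 2 * M := by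
    rw [← Finset.sum_range_add_sum_Ico _ hle]
    refine (norm_add_le _ _).trans (add_le_add le_rfl ?_)
    refine (norm_sum_le_of_le _ fun n _ => hz n).trans ?_
    rw [Finset.sum_const, Nat.card_Ico, nsmul_eq_mul, mul_one]
    have : N - M ^ 2 ≤ 2 * M := by omega
    exact_mod_cast this
  have hle' : (M : ℝ) ^ 2 ≤ N := by exact_mod_cast hle
  rw [norm_div, Complex.norm_natCast, show 2 / (M : ℝ) = 2 * M / (M : ℝ) ^ 2 by field_simp,
    ← add_div]
  exact (div_le_div_of_nonneg_right h4 hNR.le).trans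
    (div_le_div_of_nonneg_left (by positivity) (by positivity) hle')

open MeasureTheory in
/-- The averages of `exp (i t aₙ)` tend to zero for almost all `t ∈ [0, 1]`. -/
theorem ae_tendsto_sum_exp_div {a : ℕ → ℝ} {C r : ℝ} (hr0 : 0 ≤ r) (hr1 : r < 1)
    (hC : 0 ≤ C) (ha : ∀ n m, n ≠ m → a n ≠ a m ∧ 1 / |a n - a m| ≤ C * r ^ m) :
    ∀ᵐ t ∂(volume.restrict (Set.Ioc (0 : ℝ) 1)),
      Tendsto (fun N : ℕ => (∑ n ∈ Finset.range N, Complex.exp ((t * a n : ℝ) * Complex.I)) / N)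
        atTop (𝓝 0) := by
  set g : ℕ → ℝ → ℝ := fun M t =>
    ‖∑ n ∈ Finset.range ((M + 1) ^ 2), Complex.exp ((t * a n : ℝ) * Complex.I)‖ ^ 2 /
      ((M + 1 : ℕ) : ℝ) ^ 4 with hg
  have hgc : ∀ M, Continuous (g M) := fun M => by
    simp only [hg]
    fun_prop
  have hg0 : ∀ M t, 0 ≤ g M t := fun M t => by positivity
  set K := 1 + C * (1 - r)⁻¹ with hK
  have hK0 : 0 ≤ K := by
    have : 0 < 1 - r := by linarith
    positivity
  -- The second moment is linear in the number `(M + 1) ^ 2` of terms, and dividing by its square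
  -- leaves a summable bound. So `∑ g M t` is finite almost everywhere and its terms tend to zero.
  have hint : ∀ M, ∫⁻ t in Set.Ioc (0 : ℝ) 1, ENNReal.ofReal (g M t) ≤
      ENNReal.ofReal (K * (1 / ((M + 1 : ℕ) : ℝ) ^ 2)) := fun M => by
    rw [← ofReal_integral_eq_lintegral_ofReal
      (((hgc M).integrableOn_Icc (a := 0) (b := 1)).mono_set Set.Ioc_subset_Icc_self)
      (ae_of_all _ (hg0 M))]
    refine ENNReal.ofReal_le_ofReal ?_
    rw [← intervalIntegral.integral_of_le zero_le_one]
    simp only [hg, intervalIntegral.integral_div]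
    refine (div_le_div_of_nonneg_right
      (integral_norm_sum_exp_sq_le hr0 hr1 hC ha _) (by positivity)).trans (le_of_eq ?_)
    rw [← hK]
    push_cast
    field_simp
  have hsum : ∫⁻ t in Set.Ioc (0 : ℝ) 1, ∑' M, ENNReal.ofReal (g M t) ≠ ⊤ := by
    rw [lintegral_tsum fun M => (hgc M).measurable.ennreal_ofReal.aemeasurable]
    have hs : Summable fun M : ℕ => K * (1 / ((M + 1 : ℕ) : ℝ) ^ 2) :=
      ((summable_nat_add_iff (f := fun M : ℕ => 1 / (M : ℝ) ^ 2) 1).2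
        (Real.summable_one_div_nat_pow.2 one_lt_two)).mul_left K
    exact ne_top_of_le_ne_top hs.tsum_ofReal_ne_top (ENNReal.tsum_le_tsum hint)
  have hmeas : Measurable fun t => ∑' M, ENNReal.ofReal (g M t) :=
    Measurable.tsum fun M => (hgc M).measurable.ennreal_ofReal
  filter_upwards [ae_lt_top hmeas hsum] with t ht
  refine tendsto_norm_sum_div_of_sq (fun n => (Complex.norm_exp_ofReal_mul_I _).le) ?_
  have h1 := ENNReal.tendsto_atTop_zero_of_tsum_ne_top ht.ne
  have h2 := (ENNReal.tendsto_toReal ENNReal.zero_ne_top).comp h1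
  simpa only [Function.comp_def, ENNReal.toReal_ofReal (hg0 _ t), ENNReal.toReal_zero] using h2

theorem one_div_abs_pow_sub_pow_le {α : ℝ} (hα : 1 < |α|) {n m : ℕ} (h : n ≠ m) :
    α ^ n ≠ α ^ m ∧ 1 / |α ^ n - α ^ m| ≤ (1 - |α|⁻¹)⁻¹ * |α|⁻¹ ^ m := by
  have hβ : 0 < |α| := by linarith
  have h0 : 0 < 1 - |α|⁻¹ := sub_pos.2 (inv_lt_one_of_one_lt₀ hα)
  have hle : (1 - |α|⁻¹) * |α| ^ m ≤ |α ^ n - α ^ m| := by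
    rcases lt_or_gt_of_ne h with hnm | hnm
    · have h1 : |α| ^ m - |α| ^ n ≤ |α ^ n - α ^ m| := by
        rw [abs_sub_comm, ← abs_pow, ← abs_pow]
        exact abs_sub_abs_le_abs_sub _ _
      have h2 : |α| ^ n ≤ |α|⁻¹ * |α| ^ m := by
        obtain ⟨j, rfl⟩ := Nat.exists_eq_add_of_lt hnm
        rw [pow_succ, mul_comm (|α| ^ (n + j)), inv_mul_cancel_left₀ hβ.ne']
        exact pow_le_pow_right₀ hα.le (by omega)
      rw [one_sub_mul]
      exact (sub_le_sub_left h2 _).trans h1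
    · have h1 : |α| ^ n - |α| ^ m ≤ |α ^ n - α ^ m| := by
        rw [← abs_pow, ← abs_pow]
        exact abs_sub_abs_le_abs_sub _ _
      have h2 : |α| * |α| ^ m ≤ |α| ^ n := by
        rw [← pow_succ']
        exact pow_le_pow_right₀ hα.le (by omega)
      -- This is `|α| + |α|⁻¹ ≥ 2`; it lets both cases share one constant.
      have h3 : 1 - |α|⁻¹ ≤ |α| - 1 := by
        have h4 : |α|⁻¹ * |α| = 1 := inv_mul_cancel₀ hβ.ne'
        have h5 : 0 < |α|⁻¹ := inv_pos.2 hβ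
        generalize |α|⁻¹ = i at *
        nlinarith [sq_nonneg (|α| - 1)]
      have h4 := mul_le_mul_of_nonneg_right h3 (pow_pos hβ m).le
      rw [sub_one_mul] at h4
      exact h4.trans ((sub_le_sub_right h2 _).trans h1)
  have hpos : 0 < (1 - |α|⁻¹) * |α| ^ m := by positivity
  refine ⟨fun he => ?_, ?_⟩
  · rw [he, sub_self, abs_zero] at hle
    exact hle.not_gt hpos
  · rw [inv_pow, ← mul_inv, ← one_div]
    exact one_div_le_one_div_of_le hpos hle

open MeasureTheory in
-- Each frequency `h` excludes a null set of `ξ`, and there are countably many frequencies.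
theorem exists_tendsto_sum_fourier_div {α : ℝ} (hα : 1 < |α|) :
    ∃ ξ : ℝ, ∀ h : ℤ, h ≠ 0 → Tendsto (fun N : ℕ =>
      (∑ n ∈ Finset.range N, fourier h ((ξ * α ^ n : ℝ) : AddCircle (1 : ℝ))) / N) atTop (𝓝 0) := by
  have hae : ∀ h : {h : ℤ // h ≠ 0}, ∀ᵐ t ∂(volume.restrict (Set.Ioc (0 : ℝ) 1)),
      Tendsto (fun N : ℕ => (∑ n ∈ Finset.range N,
        Complex.exp ((t * (2 * Real.pi * h * α ^ n) : ℝ) * Complex.I)) / N) atTop (𝓝 0) := by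
    rintro ⟨h, hh⟩
    have hh' : (2 * Real.pi * h : ℝ) ≠ 0 := by
      have := Real.pi_ne_zero
      have : (h : ℝ) ≠ 0 := by exact_mod_cast hh
      positivity
    have h0 : 0 < 1 - |α|⁻¹ := sub_pos.2 (inv_lt_one_of_one_lt₀ hα)
    refine ae_tendsto_sum_exp_div (C := |2 * Real.pi * h|⁻¹ * (1 - |α|⁻¹)⁻¹) (r := |α|⁻¹)
      (by positivity) (inv_lt_one_of_one_lt₀ hα) (by positivity) fun n m hnm => ?_
    obtain ⟨h1, h2⟩ := one_div_abs_pow_sub_pow_le hα hnm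
    refine ⟨fun he => h1 (mul_left_cancel₀ hh' he), ?_⟩
    rw [← mul_sub, abs_mul, one_div, mul_inv, mul_assoc _⁻¹, ← one_div |α ^ n - α ^ m|]
    exact mul_le_mul_of_nonneg_left h2 (inv_nonneg.2 (abs_nonneg _))
  have hne : volume.restrict (Set.Ioc (0 : ℝ) 1) ≠ 0 := by
    rw [Ne, Measure.restrict_eq_zero]
    simp
  have : (ae (volume.restrict (Set.Ioc (0 : ℝ) 1))).NeBot := ae_neBot.2 hne
  obtain ⟨ξ, hξ⟩ := (ae_all_iff.2 hae).exists
  refine ⟨ξ, fun h hh => ?_⟩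
  refine (hξ ⟨h, hh⟩).congr fun N => ?_
  congr 1
  refine Finset.sum_congr rfl fun n _ => ?_
  rw [fourier_coe_apply]
  congr 1
  push_cast
  ring

/-! ### Weyl's criterion -/

open MeasureTheory in
-- The functions whose averages converge to their integral form a subspace `S` containing the
-- Fourier monomials. Trigonometric polynomials are uniformly dense, and averages and integral are
-- both 1-Lipschitz in the uniform norm.
theorem tendsto_average_of_tendsto_sum_fourier {x : ℕ → ℝ}
    (hx : ∀ h : ℤ, h ≠ 0 → Tendsto (fun N : ℕ =>
      (∑ n ∈ Finset.range N, fourier h (x n : AddCircle (1 : ℝ))) / N) atTop (𝓝 0))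
    (f : C(AddCircle (1 : ℝ), ℂ)) :
    Tendsto (fun N : ℕ => (∑ n ∈ Finset.range N, f (x n)) / N) atTop (𝓝 (∫ t, f t)) := by
  have hint : ∀ f : C(AddCircle (1 : ℝ), ℂ), Integrable (fun t => f t) := fun f =>
    f.continuous.integrable_of_hasCompactSupport (HasCompactSupport.of_compactSpace f)
  let S : Submodule ℂ C(AddCircle (1 : ℝ), ℂ) :=
    { carrier := {f | Tendsto (fun N : ℕ => (∑ n ∈ Finset.range N, f (x n)) / N) atTop
        (𝓝 (∫ t, f t))}
      add_mem' := fun {f g} hf hg => by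
        refine ((hf.add hg).congr fun N => ?_).trans (le_of_eq ?_)
        · simp [Finset.sum_add_distrib, add_div]
        · congr 1
          simp only [ContinuousMap.add_apply]
          exact (integral_add (hint f) (hint g)).symm
      zero_mem' := by simp
      smul_mem' := fun c f hf => by
        refine ((hf.const_mul c).congr fun N => ?_).trans (le_of_eq ?_)
        · simp only [ContinuousMap.smul_apply, smul_eq_mul, ← Finset.mul_sum, mul_div_assoc]
        · congr 1
          simp only [ContinuousMap.smul_apply]
          rw [integral_smul, smul_eq_mul] }
  have hvol : (volume : Measure (AddCircle (1 : ℝ))).real Set.univ = 1 := by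
    rw [Measure.real, AddCircle.measure_univ, ENNReal.ofReal_one, ENNReal.toReal_one]
  have hspan : Submodule.span ℂ (Set.range (@fourier 1)) ≤ S := by
    rw [Submodule.span_le]
    rintro _ ⟨h, rfl⟩
    change Tendsto _ _ _
    by_cases hh : h = 0
    · subst hh
      have h1 : ∫ t : AddCircle (1 : ℝ), (fourier 0 t : ℂ) = 1 := by
        simp [hvol]
      rw [h1]
      refine tendsto_const_nhds.congr' ?_
      filter_upwards [eventually_gt_atTop 0] with N hN
      have : (N : ℂ) ≠ 0 := by exact_mod_cast hN.ne'
      simp [this]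
    · have h1 : ∫ t : AddCircle (1 : ℝ), (fourier h t : ℂ) = 0 := by
        have := fourierCoeff_fourier (T := 1) h
        have h2 := congrFun this 0
        rw [fourierCoeff, Pi.single_eq_of_ne (Ne.symm hh)] at h2
        simp only [neg_zero, fourier_zero, one_smul] at h2
        rw [AddCircle.volume_eq_smul_haarAddCircle, integral_smul_measure, h2, smul_zero]
      rw [h1]
      exact hx h hh
  rw [Metric.tendsto_atTop]
  intro ε hε
  have hf : f ∈ (Submodule.span ℂ (Set.range (@fourier 1))).topologicalClosure := by
    rw [span_fourier_closure_eq_top]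
    trivial
  obtain ⟨g, hg, hfg⟩ := Metric.mem_closure_iff.1 hf (ε / 4) (by linarith)
  obtain ⟨M, hM⟩ := Metric.tendsto_atTop.1 (hspan hg) (ε / 4) (by linarith)
  have hfg' : ∀ t, ‖f t - g t‖ ≤ ε / 4 := fun t => by
    rw [← dist_eq_norm]
    exact (ContinuousMap.dist_apply_le_dist t).trans hfg.le
  refine ⟨M, fun N hN => ?_⟩
  have h1 : dist ((∑ n ∈ Finset.range N, f (x n)) / N) ((∑ n ∈ Finset.range N, g (x n)) / (N : ℂ))
      ≤ ε / 4 := by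
    rcases Nat.eq_zero_or_pos N with h0 | h0
    · subst h0
      simp
      linarith
    have h0' : (0 : ℝ) < N := by exact_mod_cast h0
    rw [dist_eq_norm, ← sub_div, ← Finset.sum_sub_distrib, norm_div, Complex.norm_natCast,
      div_le_iff₀ h0']
    refine (norm_sum_le_of_le _ fun n _ => hfg' _).trans (le_of_eq ?_)
    simp [mul_comm]
  have h2 : dist (∫ t, g t) (∫ t, f t) ≤ ε / 4 := by
    rw [dist_comm, dist_eq_norm, ← integral_sub (hint f) (hint g)]
    refine (norm_integral_le_of_norm_le_const (ae_of_all _ hfg')).trans (le_of_eq ?_)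
    rw [hvol, mul_one]
  have h3 := hM N hN
  calc _ ≤ _ := dist_triangle4 _ _ _ _
    _ < ε / 4 + ε / 4 + ε / 4 := add_lt_add_of_lt_of_le (add_lt_add_of_le_of_lt h1 h3) h2
    _ ≤ ε := by clear h1 h2 h3; linarith

open MeasureTheory in
theorem volume_image_Icc_le {a b : ℝ} (hb : b < a + 1) :
    volume ((fun t : ℝ => (t : AddCircle (1 : ℝ))) '' Set.Icc a b) ≤ ENNReal.ofReal (b - a) := by
  have hcl : IsClosed ((fun t : ℝ => (t : AddCircle (1 : ℝ))) '' Set.Icc a b) :=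
    (isCompact_Icc.image (AddCircle.continuous_mk' 1)).isClosed
  rw [← (AddCircle.measurePreserving_mk 1 a).measure_preimage
    hcl.measurableSet.nullMeasurableSet]
  refine (Measure.restrict_apply
    ((AddCircle.continuous_mk' 1).measurable hcl.measurableSet)).trans_le ?_
  -- The point `a + 1` must be allowed because it is identified with `a`; it has measure zero.
  have hsub : (fun t : ℝ => (t : AddCircle (1 : ℝ))) ⁻¹'
      ((fun t : ℝ => (t : AddCircle (1 : ℝ))) '' Set.Icc a b) ∩ Set.Ioc a (a + 1) ⊆
      Set.Icc a b ∪ {a + 1} := by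
    rintro t ⟨⟨s, hs, hst⟩, ht⟩
    rcases ht.2.eq_or_lt with h | h
    · exact Or.inr h
    · refine Or.inl ?_
      rwa [← (AddCircle.coe_eq_coe_iff_of_mem_Ico (p := 1) (a := a) ⟨hs.1, hs.2.trans_lt hb⟩
        ⟨ht.1.le, h⟩).1 hst]
  refine (measure_mono hsub).trans ((measure_union_le _ _).trans ?_)
  simp

open MeasureTheory in
/-- Weyl's criterion for uniform distribution. -/
theorem HasArcBounds.of_tendsto_sum_fourier {x : ℕ → ℝ}
    (hx : ∀ h : ℤ, h ≠ 0 → Tendsto (fun N : ℕ =>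
      (∑ n ∈ Finset.range N, fourier h (x n : AddCircle (1 : ℝ))) / N) atTop (𝓝 0)) :
    HasArcBounds x := by
  intro a b hab ε hε
  rcases le_or_gt 1 (b - a) with h1 | h1
  · refine Eventually.of_forall fun N => ?_
    have h2 : (countBelow {n | x n ∈ openArc a b} N : ℝ) ≤ N := by
      exact_mod_cast countBelow_le _ _
    nlinarith [(Nat.cast_nonneg N : (0 : ℝ) ≤ N)]
  set E := (fun t : ℝ => (t : AddCircle (1 : ℝ))) '' Set.Icc a b with hE
  have hcl : IsClosed E := (isCompact_Icc.image (AddCircle.continuous_mk' 1)).isClosed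
  have hvol : volume E ≤ ENNReal.ofReal (b - a) := volume_image_Icc_le (by linarith)
  have hδ : ∀ n : ℕ, (0 : ℝ) < 1 / (n + 1) := fun n => by positivity
  -- Thickened indicators are continuous, equal `1` on `E`, and have integrals converging to its
  -- measure; the average of a fine enough one bounds the visiting frequency from above.
  have htend := tendsto_lintegral_thickenedIndicator_of_isClosed (volume : Measure (AddCircle (1:ℝ)))
    hcl hδ tendsto_one_div_add_atTop_nhds_zero_nat
  have hlt : volume E < ENNReal.ofReal (b - a + ε / 2) :=
    hvol.trans_lt ((ENNReal.ofReal_lt_ofReal_iff (by linarith)).2 (by linarith))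
  obtain ⟨k, hk⟩ := (htend.eventually_lt_const hlt).exists
  set g := thickenedIndicator (hδ k) E with hg
  let f : C(AddCircle (1 : ℝ), ℂ) := ⟨fun t => ((g t : ℝ) : ℂ), by fun_prop⟩
  have hfint : ∫ t, f t = ((∫ t, (g t : ℝ) : ℝ) : ℂ) := integral_ofReal
  have hgint : ∫ t, (g t : ℝ) < b - a + ε := by
    have h2 : ENNReal.ofReal (∫ t, (g t : ℝ)) = ∫⁻ t, (g t : ENNReal) := by
      have hc : Continuous fun t => (g t : ℝ) := by fun_prop
      rw [ofReal_integral_eq_lintegral_ofReal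
        (hc.integrable_of_hasCompactSupport (HasCompactSupport.of_compactSpace _))
        (ae_of_all _ fun t => (g t).coe_nonneg)]
      simp only [ENNReal.ofReal_coe_nnreal]
    rw [← h2, ENNReal.ofReal_lt_ofReal_iff (by linarith)] at hk
    linarith
  have h2 := tendsto_average_of_tendsto_sum_fourier hx f
  rw [hfint] at h2
  have h3 := (Complex.continuous_re.tendsto _).comp h2
  rw [Complex.ofReal_re] at h3
  filter_upwards [h3.eventually_lt_const hgint, eventually_gt_atTop 0] with N h4 hN
  have hN' : (0 : ℝ) < N := by exact_mod_cast hN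
  have h5 : ((∑ n ∈ Finset.range N, f (x n)) / (N : ℂ)).re =
      (∑ n ∈ Finset.range N, (g (x n) : ℝ)) / N := by
    have : (∑ n ∈ Finset.range N, f (x n)) / (N : ℂ) =
      (((∑ n ∈ Finset.range N, (g (x n) : ℝ)) / N : ℝ) : ℂ) := by
      push_cast
      rfl
    rw [this, Complex.ofReal_re]
  rw [Function.comp_apply, h5, div_lt_iff₀ hN'] at h4
  refine le_trans ?_ h4.le
  classical
  rw [countBelow_setOf, Finset.card_filter]
  push_cast
  refine Finset.sum_le_sum fun n _ => ?_
  split_ifs with h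
  · obtain ⟨m, hm1, hm2⟩ := h
    have hmem : ((x n : ℝ) : AddCircle (1 : ℝ)) ∈ E := by
      refine ⟨x n - m, ⟨hm1.le, hm2.le⟩, ?_⟩
      have h6 : ((m : ℝ) : AddCircle (1 : ℝ)) = 0 :=
        (AddCircle.coe_eq_zero_iff 1).2 ⟨m, by simp⟩
      simp [h6]
    rw [hg, thickenedIndicator_one (hδ k) E hmem]
    simp
  · positivity

/-- There is a real number that is normal in base `α`. -/
theorem exists_hasArcBounds {α : ℝ} (hα : 1 < |α|) : ∃ ξ : ℝ, HasArcBounds fun n => ξ * α ^ n := by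
  obtain ⟨ξ, hξ⟩ := exists_tendsto_sum_fourier_div hα
  exact ⟨ξ, .of_tendsto_sum_fourier hξ⟩

/-! ### Powers of Pisot numbers -/

open IntermediateField in
-- The integer is the trace of `β ^ n`. It differs from `β ^ n` by the sum of the `n`-th powers of
-- the finitely many other conjugates, all of absolute value below a common `ρ < 1`.
theorem exists_abs_pow_sub_intCast_le_of_conj {F : Type*} [Field F] [CharZero F]
    [IsFractionRing ℤ F] [Algebra F ℝ] [Algebra F ℂ] [IsScalarTower F ℝ ℂ] {β : ℝ}
    (hint : IsIntegral ℤ β)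
    (hconj : ∀ z : ℂ, Polynomial.aeval z (minpoly F β) = 0 → z ≠ (β : ℂ) → ‖z‖ < 1) :
    ∃ (u : ℕ → ℤ) (C ρ : ℝ), 0 ≤ C ∧ 0 < ρ ∧ ρ < 1 ∧ ∀ n, |β ^ n - u n| ≤ C * ρ ^ n := by
  classical
  have hintF : IsIntegral F β := hint.tower_top
  have hfin : FiniteDimensional F F⟮β⟯ := adjoin.finiteDimensional hintF
  obtain ⟨g, hg⟩ : ∃ g, g = AdjoinSimple.gen F β := ⟨_, rfl⟩
  have hgβ : (g : ℝ) = β := by rw [hg]; exact AdjoinSimple.coe_gen F β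
  have hgint : IsIntegral ℤ g := by
    refine (isIntegral_algHom_iff (R := ℤ) ((F⟮β⟯).val.restrictScalars ℤ)
      Subtype.val_injective).1 ?_
    change IsIntegral ℤ (g : ℝ)
    rwa [hgβ]
  choose u hu using fun n : ℕ => (IsIntegrallyClosed.isIntegral_iff (R := ℤ) (K := F)).1
    (Algebra.isIntegral_trace (R := ℤ) (L := F) (hgint.pow n))
  let σ₀ : F⟮β⟯ →ₐ[F] ℂ := (IsScalarTower.toAlgHom F ℝ ℂ).comp (F⟮β⟯).val
  have hσ₀ : σ₀ g = (β : ℂ) := by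
    change ((g : ℝ) : ℂ) = β
    rw [hgβ]
  have hlt : ∀ σ : F⟮β⟯ →ₐ[F] ℂ, σ ≠ σ₀ → ‖σ g‖ < 1 := by
    intro σ hσ
    refine hconj _ ?_ fun h => hσ ?_
    · rw [← minpoly_gen F β, ← hg, Polynomial.aeval_algHom_apply, minpoly.aeval, map_zero]
    · refine (adjoin.powerBasis hintF).algHom_ext ?_
      rw [adjoin.powerBasis_gen, ← hg, h, hσ₀]
  have hev : ∀ᶠ ρ : ℝ in 𝓝[<] 1, 0 < ρ ∧ ρ < 1 ∧
      ∀ σ ∈ Finset.univ.erase σ₀, ‖σ g‖ < ρ := by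
    refine (eventually_nhdsWithin_of_eventually_nhds (eventually_gt_nhds one_pos)).and
      (eventually_mem_nhdsWithin.and ?_)
    rw [Filter.eventually_all_finset]
    exact fun σ hσ => eventually_nhdsWithin_of_eventually_nhds
      (eventually_gt_nhds (hlt σ (Finset.ne_of_mem_erase hσ)))
  obtain ⟨ρ, h0, h1, hρ⟩ := hev.exists
  refine ⟨u, (Finset.univ.erase σ₀).card, ρ, by positivity, h0, h1, fun n => ?_⟩
  have htr := trace_eq_sum_embeddings ℂ (K := F) (L := F⟮β⟯) (x := g ^ n)
  rw [← hu n, ← Finset.add_sum_erase _ _ (Finset.mem_univ σ₀), map_pow, hσ₀] at htr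
  have h2 : ((β ^ n - u n : ℝ) : ℂ) = -∑ σ ∈ Finset.univ.erase σ₀, σ (g ^ n) := by
    rw [eq_neg_iff_add_eq_zero]
    have h3 : algebraMap F ℂ (algebraMap ℤ F (u n)) = (u n : ℂ) := by simp
    rw [h3] at htr
    push_cast
    linear_combination -htr
  rw [← Real.norm_eq_abs, ← Complex.norm_real, h2, norm_neg]
  refine (norm_sum_le_of_le (n := fun _ => ρ ^ n) _ fun σ hσ => ?_).trans (le_of_eq ?_)
  · rw [map_pow, norm_pow]
    exact pow_le_pow_left₀ (norm_nonneg _) (hρ σ hσ).le n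
  · rw [Finset.sum_const, nsmul_eq_mul]

/-- The powers of a Pisot number approach the integers exponentially fast. -/
theorem IsPisot.exists_abs_pow_sub_intCast_le {β : ℝ} (hβ : IsPisot β) :
    ∃ (u : ℕ → ℤ) (C ρ : ℝ), 0 ≤ C ∧ 0 < ρ ∧ ρ < 1 ∧ ∀ n, |β ^ n - u n| ≤ C * ρ ^ n :=
  exists_abs_pow_sub_intCast_le_of_conj (F := ℚ) hβ.2.1 hβ.2.2

theorem exists_abs_pow_sub_intCast_le_of_isPisot_abs {α : ℝ} (hα : IsPisot |α|) :
    ∃ (u : ℕ → ℤ) (C ρ : ℝ), 0 ≤ C ∧ 0 < ρ ∧ ρ < 1 ∧ ∀ n, |α ^ n - u n| ≤ C * ρ ^ n := by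
  obtain ⟨u, C, ρ, hC, h0, h1, h⟩ := hα.exists_abs_pow_sub_intCast_le
  rcases abs_choice α with ha | ha
  · rw [ha] at h
    exact ⟨u, C, ρ, hC, h0, h1, h⟩
  · refine ⟨fun n => (-1) ^ n * u n, C, ρ, hC, h0, h1, fun n => ?_⟩
    have h2 : α ^ n - ((-1) ^ n * u n : ℤ) = (-1) ^ n * (|α| ^ n - u n) := by
      have h3 : α ^ n = (-1) ^ n * |α| ^ n := by rw [ha, ← mul_pow, neg_mul_neg, one_mul]
      rw [h3]
      push_cast
      ring
    rw [h2, abs_mul, abs_pow, abs_neg, abs_one, one_pow, one_mul]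
    exact h n

/-! ### Expansions in base `α` -/

/-- With truncated subtraction the exponent is the distance `|n - m|`; each side of `n` contributes
at most one geometric series. -/
theorem tsum_pow_dist_le {q : ℝ} (h0 : 0 ≤ q) (h1 : q < 1) (n : ℕ) :
    Summable (fun m : ℕ => q ^ ((n - m) + (m - n))) ∧
      ∑' m : ℕ, q ^ ((n - m) + (m - n)) ≤ 2 * (1 - q)⁻¹ := by
  have hgeo := summable_geometric_of_lt_one h0 h1
  have heq : ∀ m : ℕ, q ^ ((n - (m + n)) + (m + n - n)) = q ^ m := fun m => by
    congr 1
    omega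
  have hs : Summable fun m : ℕ => q ^ ((n - m) + (m - n)) := by
    rw [← summable_nat_add_iff n]
    simpa only [heq] using hgeo
  refine ⟨hs, ?_⟩
  rw [← hs.sum_add_tsum_nat_add n, two_mul, ← tsum_geometric_of_lt_one h0 h1]
  simp only [heq]
  gcongr
  have h2 : ∑ m ∈ Finset.range n, q ^ ((n - m) + (m - n)) = ∑ j ∈ Finset.range n, q ^ (j + 1) := by
    rw [← Finset.sum_range_reflect (fun j => q ^ (j + 1))]
    refine Finset.sum_congr rfl fun m hm => ?_
    have := Finset.mem_range.1 hm
    congr 1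
    omega
  rw [h2]
  calc _ ≤ ∑ j ∈ Finset.range n, q ^ j :=
        Finset.sum_le_sum fun j _ => pow_le_pow_of_le_one h0 h1.le (Nat.le_succ j)
    _ ≤ _ := hgeo.sum_le_tsum _ fun _ _ => by positivity

theorem summable_intCast_mul_inv_pow {α D : ℝ} (hα : 1 < |α|) {s : ℕ → ℤ}
    (hs : ∀ m, |(s m : ℝ)| ≤ D) : Summable fun m => (s m : ℝ) * α⁻¹ ^ m := by
  refine Summable.of_norm_bounded (g := fun m => D * |α|⁻¹ ^ m)
    ((summable_geometric_of_lt_one (by positivity) (inv_lt_one_of_one_lt₀ hα)).mul_left D)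
    fun m => ?_
  rw [norm_mul, norm_pow, Real.norm_eq_abs, Real.norm_eq_abs, abs_inv]
  exact mul_le_mul_of_nonneg_right (hs m) (by positivity)

/-- If the digits near place `n` vanish, then the real number with these bounded integer digits in
base `α`, multiplied by `α ^ n`, is close to an integer. -/
theorem exists_abs_tsum_mul_pow_sub_lt {α : ℝ} (hα : IsPisot |α|) {D ε : ℝ} (hε : 0 < ε) :
    ∃ L : ℕ, ∀ s : ℕ → ℤ, (∀ m, |(s m : ℝ)| ≤ D) → ∀ n : ℕ,
      (∀ m, n ≤ m + L → m ≤ n + L → s m = 0) →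
      ∃ z : ℤ, |(∑' m, (s m : ℝ) * α⁻¹ ^ m) * α ^ n - z| < ε := by
  have hα1 : 1 < |α| := hα.1
  have hα0 : α ≠ 0 := by
    rintro rfl
    simp at hα1
    linarith
  obtain ⟨u, C', ρ, hC', hρ0, hρ1, hu⟩ := exists_abs_pow_sub_intCast_le_of_isPisot_abs hα
  set r := max ρ |α|⁻¹ with hr
  have hr0 : 0 < r := lt_max_of_lt_left hρ0
  have hr1 : r < 1 := max_lt hρ1 (inv_lt_one_of_one_lt₀ hα1)
  -- The decay `r ^ d` at distance `d` is split as `q ^ d * q ^ d`: one factor is at most `q ^ L`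
  -- since digits within `L` vanish, the other is summable over places.
  set q := √r with hq
  have hq0 : 0 < q := Real.sqrt_pos.2 hr0
  have hq1 : q < 1 := by
    rw [hq, Real.sqrt_lt' one_pos]
    simpa using hr1
  have hqr : q ^ 2 = r := Real.sq_sqrt hr0.le
  set C := max C' 1
  have hC0 : 0 ≤ C := zero_le_one.trans (le_max_right _ _)
  have htend : Tendsto (fun L : ℕ => |D| * C * q ^ L * (2 * (1 - q)⁻¹)) atTop (𝓝 0) := by
    have := ((tendsto_pow_atTop_nhds_zero_of_lt_one hq0.le hq1).const_mul (|D| * C)).mul_const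
      (2 * (1 - q)⁻¹)
    simpa using this
  obtain ⟨L, hL⟩ := (htend.eventually_lt_const hε).exists
  refine ⟨L, fun s hs n hn => ?_⟩
  -- For `m ≤ n` the power `α ^ (n - m)` is replaced by its integer approximation; places beyond `n`
  -- carry negative powers of `α` and are themselves small.
  refine ⟨∑ m ∈ Finset.range (n + 1), s m * u (n - m), lt_of_le_of_lt ?_ hL⟩
  set t : ℕ → ℝ := fun m => (s m : ℝ) * α⁻¹ ^ m * α ^ n -
    (if m ≤ n then (s m : ℝ) * u (n - m) else 0) with ht
  have hfin : HasSum (fun m => if m ≤ n then (s m : ℝ) * u (n - m) else 0)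
      ((∑ m ∈ Finset.range (n + 1), s m * u (n - m) : ℤ) : ℝ) := by
    have h := hasSum_sum_of_ne_finset_zero (L := .unconditional ℕ) (f := fun m => if m ≤ n then (s m : ℝ) * u (n - m) else 0)
      (s := Finset.range (n + 1)) fun m hm => by
        rw [Finset.mem_range, Nat.lt_succ_iff] at hm
        simp [hm]
    convert h using 1
    push_cast
    refine Finset.sum_congr rfl fun m hm => ?_
    rw [Finset.mem_range, Nat.lt_succ_iff] at hm
    simp [hm]
  have hsum : (∑' m, (s m : ℝ) * α⁻¹ ^ m) * α ^ n -
      ((∑ m ∈ Finset.range (n + 1), s m * u (n - m) : ℤ) : ℝ) = ∑' m, t m :=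
    (((summable_intCast_mul_inv_pow hα1 hs).hasSum.mul_right (α ^ n)).sub hfin).tsum_eq.symm
  obtain ⟨hqs, hqt⟩ := tsum_pow_dist_le hq0.le hq1 n
  have htm : ∀ m, ‖t m‖ ≤ |D| * C * q ^ L * q ^ ((n - m) + (m - n)) := by
    intro m
    by_cases hsm : s m = 0
    · simp only [ht, hsm]
      simp only [Int.cast_zero, zero_mul, ite_self, sub_self, norm_zero]
      positivity
    have hfar : L ≤ (n - m) + (m - n) := by
      by_contra hlt
      exact hsm (hn m (by omega) (by omega))
    have h1 : ‖t m‖ ≤ |D| * (C * r ^ ((n - m) + (m - n))) := by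
      have hsD : |(s m : ℝ)| ≤ |D| := (hs m).trans (le_abs_self D)
      rcases le_or_gt m n with hmn | hmn
      · have h2 : t m = s m * (α ^ (n - m) - u (n - m)) := by
          simp only [ht, if_pos hmn]
          rw [pow_sub₀ α hα0 hmn, inv_pow]
          ring
        rw [h2, norm_mul, Real.norm_eq_abs, Real.norm_eq_abs, Nat.sub_eq_zero_of_le hmn, add_zero]
        refine mul_le_mul hsD ((hu _).trans ?_) (abs_nonneg _) (abs_nonneg _)
        exact mul_le_mul (le_max_left _ _) (pow_le_pow_left₀ hρ0.le (le_max_left _ _) _)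
          (by positivity) hC0
      · have h2 : t m = s m * α⁻¹ ^ (m - n) := by
          simp only [ht, if_neg (not_le.2 hmn)]
          rw [pow_sub₀ α⁻¹ (inv_ne_zero hα0) hmn.le, inv_pow, inv_pow, inv_inv]
          ring
        rw [h2, norm_mul, Real.norm_eq_abs, Real.norm_eq_abs, Nat.sub_eq_zero_of_le hmn.le, zero_add,
          abs_pow, abs_inv]
        refine mul_le_mul hsD ?_ (by positivity) (abs_nonneg _)
        rw [← one_mul (|α|⁻¹ ^ _)]
        exact mul_le_mul (le_max_right _ _) (pow_le_pow_left₀ (by positivity) (le_max_right _ _) _)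
          (by positivity) hC0
    refine h1.trans ?_
    rw [mul_assoc, mul_assoc, ← hqr, ← pow_mul, two_mul, pow_add]
    refine mul_le_mul_of_nonneg_left (mul_le_mul_of_nonneg_left
      (mul_le_mul_of_nonneg_right ?_ (by positivity)) hC0) (abs_nonneg _)
    exact pow_le_pow_of_le_one hq0.le hq1.le hfar
  rw [hsum, ← Real.norm_eq_abs]
  refine (tsum_of_norm_bounded (hqs.hasSum.mul_left _) htm).trans ?_
  exact mul_le_mul_of_nonneg_left hqt (by positivity)

/-- The successive remainders of the nearest integer expansion of `ξ` in base `α`. -/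
noncomputable def expansionRemainder (α ξ : ℝ) : ℕ → ℝ
  | 0 => ξ
  | n + 1 => α * (expansionRemainder α ξ n - round (expansionRemainder α ξ n))

/-- Every real number has an expansion in base `α` with bounded integer digits. -/
theorem exists_hasSum_intCast_mul_inv_pow {α : ℝ} (hα : 1 < |α|) (ξ : ℝ) :
    ∃ (s : ℕ → ℤ) (D : ℝ), (∀ m, |(s m : ℝ)| ≤ D) ∧ HasSum (fun m => (s m : ℝ) * α⁻¹ ^ m) ξ := by
  have hα0 : α ≠ 0 := by
    rintro rfl
    simp at hα
    linarith
  set R := expansionRemainder α ξ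
  have hR : ∀ n, R (n + 1) = α * (R n - round (R n)) := fun n => rfl
  have hRb : ∀ n, |R n| ≤ |ξ| + |α| := fun n => by
    rcases n with _ | n
    · exact le_add_of_nonneg_right (abs_nonneg α)
    · rw [hR, abs_mul]
      nlinarith [abs_sub_round (R n), abs_nonneg ξ, abs_nonneg α]
  have hs : ∀ m, |((round (R m) : ℤ) : ℝ)| ≤ |ξ| + |α| + 1 := fun m => by
    have h1 := abs_sub_round (R m)
    have h2 := hRb m
    rw [abs_le] at *
    constructor <;> linarith
  refine ⟨fun m => round (R m), _, hs, ?_⟩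
  rw [(summable_intCast_mul_inv_pow hα hs).hasSum_iff_tendsto_nat]
  have h1 : ∀ M, ∑ m ∈ Finset.range M, ((round (R m) : ℤ) : ℝ) * α⁻¹ ^ m = ξ - R M * α⁻¹ ^ M := by
    intro M
    induction M with
    | zero => simp [R, expansionRemainder]
    | succ M ih =>
      rw [Finset.sum_range_succ, ih, hR, pow_succ]
      field_simp
      ring
  simp only [h1]
  have h2 : Tendsto (fun M : ℕ => R M * α⁻¹ ^ M) atTop (𝓝 0) := by
    refine squeeze_zero_norm (a := fun M => (|ξ| + |α|) * |α|⁻¹ ^ M) (fun M => ?_) ?_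
    · rw [norm_mul, norm_pow, Real.norm_eq_abs, Real.norm_eq_abs, abs_inv]
      exact mul_le_mul_of_nonneg_right (hRb M) (by positivity)
    · simpa using (tendsto_pow_atTop_nhds_zero_of_lt_one (by positivity)
        (inv_lt_one_of_one_lt₀ hα)).const_mul (|ξ| + |α|)
  simpa using tendsto_const_nhds.sub h2

/-! ### Erasing digits of a normal number -/

/-- The terminal segments of the dyadic blocks `[2 ^ i, 2 ^ (i + 1))` of relative length
`1 / (y i + 1)`. -/
def dyadicTails (y : ℕ → ℕ) : Set ℕ :=
  {n | 2 ^ (Nat.log 2 n + 1) ≤ n + 2 ^ Nat.log 2 n / (y (Nat.log 2 n) + 1)}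

theorem mem_dyadicTails {y : ℕ → ℕ} {i n : ℕ} (h0 : 2 ^ (i + 1) ≤ n + 2 ^ i / (y i + 1))
    (h1 : n < 2 ^ (i + 1)) : n ∈ dyadicTails y := by
  have h2 : 2 ^ i / (y i + 1) ≤ 2 ^ i := Nat.div_le_self _ _
  have h3 : 2 ^ (i + 1) = 2 ^ i + 2 ^ i := by ring
  have hlog : Nat.log 2 n = i := Nat.log_eq_of_pow_le_of_lt_pow (by omega) h1
  simp only [dyadicTails, Set.mem_ofPred_eq, hlog]
  exact h0

/-- Once `y i ≥ K`, block `i` contributes at most `2 ^ i / (K + 1)` places. The blocks reaching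
below `N` have total length at most `2 * N`, so the count is at most `2 * N / (K + 1)` plus a
constant. -/
theorem hasZeroDensity_dyadicTails {y : ℕ → ℕ} (hy : Tendsto y atTop atTop) :
    HasZeroDensity (dyadicTails y) := by
  classical
  intro ε hε
  obtain ⟨K, hK⟩ := exists_nat_one_div_lt (show 0 < ε / 4 by positivity)
  obtain ⟨I, hI⟩ := eventually_atTop.1 (hy.eventually_ge_atTop K)
  have hcount : ∀ N, countBelow (dyadicTails y) N ≤
      2 ^ I + ∑ i ∈ Finset.range (Nat.log 2 N + 1), 2 ^ i / (K + 1) := fun N => by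
    have hsub : (Finset.range N).filter (· ∈ dyadicTails y) ⊆ Finset.range (2 ^ I) ∪
        (Finset.range (Nat.log 2 N + 1)).biUnion fun i =>
          Finset.Ico (2 ^ (i + 1) - 2 ^ i / (K + 1)) (2 ^ (i + 1)) := by
      intro n hn
      obtain ⟨hnN, hn⟩ := Finset.mem_filter.1 hn
      simp only [Finset.mem_range, dyadicTails, Set.mem_ofPred_eq,
        Finset.mem_union, Finset.mem_biUnion, Finset.mem_Ico] at hnN hn ⊢
      rcases lt_or_ge n (2 ^ I) with h | h
      · exact Or.inl h
      · have hIl : I ≤ Nat.log 2 n := Nat.le_log_of_pow_le one_lt_two h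
        have h1 : 2 ^ Nat.log 2 n / (y (Nat.log 2 n) + 1) ≤ 2 ^ Nat.log 2 n / (K + 1) :=
          Nat.div_le_div_left (Nat.succ_le_succ (hI _ hIl)) (Nat.succ_pos K)
        exact Or.inr ⟨Nat.log 2 n, Nat.lt_succ_of_le (Nat.log_mono_right hnN.le), by omega,
          Nat.lt_pow_succ_log_self one_lt_two n⟩
    refine (Finset.card_le_card hsub).trans ((Finset.card_union_le _ _).trans ?_)
    rw [Finset.card_range]
    refine Nat.add_le_add_left (Finset.card_biUnion_le.trans (Finset.sum_le_sum fun i _ => ?_)) _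
    rw [Nat.card_Ico]
    exact tsub_tsub_le
  have hsum : ∀ n : ℕ, (K + 1) * ∑ i ∈ Finset.range n, 2 ^ i / (K + 1) ≤ 2 ^ n := fun n => by
    induction n with
    | zero => simp
    | succ n ih =>
      rw [Finset.sum_range_succ, mul_add, pow_succ, mul_two]
      exact Nat.add_le_add ih (Nat.mul_div_le _ _)
  have hlarge : ∀ᶠ N : ℕ in atTop, (2 ^ I : ℝ) ≤ ε / 2 * N :=
    (tendsto_natCast_atTop_atTop.const_mul_atTop (by positivity)).eventually_ge_atTop _
  filter_upwards [hlarge, eventually_gt_atTop 0] with N h1 hN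
  have h2 : (K + 1) * ∑ i ∈ Finset.range (Nat.log 2 N + 1), 2 ^ i / (K + 1) ≤ 2 * N := by
    refine (hsum _).trans ?_
    rw [pow_succ, mul_comm]
    exact Nat.mul_le_mul_left _ (Nat.pow_log_le_self 2 hN.ne')
  have h3 : ((K : ℝ) + 1) * ((∑ i ∈ Finset.range (Nat.log 2 N + 1), 2 ^ i / (K + 1) : ℕ) : ℝ) ≤
      2 * N := by exact_mod_cast h2
  have h4 : (countBelow (dyadicTails y) N : ℝ) ≤
      2 ^ I + ((∑ i ∈ Finset.range (Nat.log 2 N + 1), 2 ^ i / (K + 1) : ℕ) : ℝ) := by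
    exact_mod_cast hcount N
  have hK1 : (0 : ℝ) < K + 1 := by positivity
  have hKε : 1 ≤ ε / 4 * (K + 1) := ((div_lt_iff₀ hK1).1 hK).le
  have h5 : ((∑ i ∈ Finset.range (Nat.log 2 N + 1), 2 ^ i / (K + 1) : ℕ) : ℝ) ≤ ε / 2 * N := by
    have hN' : (0 : ℝ) ≤ N := Nat.cast_nonneg N
    refine le_of_mul_le_mul_left (h3.trans ?_) hK1
    nlinarith
  linarith

theorem countBelow_add_le_of_Ico_subset {A : Set ℕ} {M N p q : ℕ} (hMN : M ≤ N) (hp : M ≤ p)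
    (hq : q ≤ N) (h : ∀ n, p ≤ n → n < q → n ∈ A) :
    countBelow A M + (q - p) ≤ countBelow A N := by
  classical
  unfold countBelow
  rw [← Nat.card_Ico p q, ← Finset.card_union_of_disjoint]
  · refine Finset.card_le_card fun n hn => ?_
    simp only [Finset.mem_union, Finset.mem_filter, Finset.mem_range, Finset.mem_Ico] at hn ⊢
    rcases hn with hn | hn
    · exact ⟨hn.1.trans_le hMN, hn.2⟩
    · exact ⟨hn.2.trans_le hq, h n hn.1 hn.2⟩
  · rw [Finset.disjoint_left]
    intro n hn hn'
    simp only [Finset.mem_filter, Finset.mem_range, Finset.mem_Ico] at hn hn'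
    omega

open Classical in
/-- The digit sequence `s` with the digits at the places in `dyadicTails y` replaced by zero. -/
noncomputable def eraseTails (s : ℕ → ℤ) (y : ℕ → ℕ) (m : ℕ) : ℤ :=
  if m ∈ dyadicTails y then 0 else s m

theorem abs_eraseTails_le {s : ℕ → ℤ} {D : ℝ} (hs : ∀ m, |(s m : ℝ)| ≤ D) (y : ℕ → ℕ) (m : ℕ) :
    |(eraseTails s y m : ℝ)| ≤ D := by
  unfold eraseTails
  split_ifs
  · simpa using (abs_nonneg _).trans (hs m)
  · exact hs m

/-- Digit `m` depends only on the discrete coordinate `y (Nat.log 2 m)`, and the series is dominated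
uniformly in `y`. -/
theorem continuous_tsum_eraseTails {α D : ℝ} (hα : 1 < |α|) {s : ℕ → ℤ}
    (hs : ∀ m, |(s m : ℝ)| ≤ D) :
    Continuous fun y : ℕ → ℕ => ∑' m, (eraseTails s y m : ℝ) * α⁻¹ ^ m := by
  classical
  refine continuous_tsum (u := fun m => D * |α|⁻¹ ^ m) (fun m => ?_)
    ((summable_geometric_of_lt_one (by positivity) (inv_lt_one_of_one_lt₀ hα)).mul_left D)
    fun m y => ?_
  · have h : (fun y : ℕ → ℕ => (eraseTails s y m : ℝ) * α⁻¹ ^ m) =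
        (fun k : ℕ => ((if 2 ^ (Nat.log 2 m + 1) ≤ m + 2 ^ Nat.log 2 m / (k + 1) then 0 else s m : ℤ)
          : ℝ) * α⁻¹ ^ m) ∘ fun y : ℕ → ℕ => y (Nat.log 2 m) := by
      ext y
      by_cases h : 2 ^ (Nat.log 2 m + 1) ≤ m + 2 ^ Nat.log 2 m / (y (Nat.log 2 m) + 1) <;>
        simp [eraseTails, dyadicTails, h]
    rw [h]
    exact continuous_of_discreteTopology.comp (continuous_apply _)
  · rw [norm_mul, norm_pow, Real.norm_eq_abs, Real.norm_eq_abs, abs_inv]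
    exact mul_le_mul_of_nonneg_right (abs_eraseTails_le hs y m) (by positivity)

/-- The difference from `ξ` has digits supported on `dyadicTails y`. Multiplied by `α ^ n` it is
close to an integer unless `n` is within `L` of that set, which happens only on a set of density
zero. -/
theorem isUniformlyDistributedModOne_eraseTails {α D ξ : ℝ} (hα : IsPisot |α|) {s : ℕ → ℤ}
    (hs : ∀ m, |(s m : ℝ)| ≤ D) (hξ : HasSum (fun m => (s m : ℝ) * α⁻¹ ^ m) ξ)
    (hξu : HasArcBounds fun n => ξ * α ^ n) {y : ℕ → ℕ} (hy : Tendsto y atTop atTop) :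
    IsUniformlyDistributedModOne
      fun n => (∑' m, (eraseTails s y m : ℝ) * α⁻¹ ^ m) * α ^ n := by
  refine (hξu.congr fun ε hε => ?_).isUniformlyDistributedModOne
  obtain ⟨L, hL⟩ := exists_abs_tsum_mul_pow_sub_lt hα (D := D) hε
  refine ((hasZeroDensity_dyadicTails hy).thickening L).mono fun n hn => ?_
  by_contra hn'
  refine hn ?_
  have hd : ∀ m, eraseTails s y m - s m = 0 ∨ m ∈ dyadicTails y ∧ eraseTails s y m - s m = -s m := by
    intro m
    by_cases h : m ∈ dyadicTails y <;> simp [eraseTails, h]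
  have hsum : ∑' m, ((eraseTails s y m - s m : ℤ) : ℝ) * α⁻¹ ^ m =
      (∑' m, (eraseTails s y m : ℝ) * α⁻¹ ^ m) - ξ := by
    rw [← hξ.tsum_eq, ← (summable_intCast_mul_inv_pow hα.1 (abs_eraseTails_le hs y)).tsum_sub
      hξ.summable]
    refine tsum_congr fun m => ?_
    push_cast
    ring
  have hdD : ∀ m, |((eraseTails s y m - s m : ℤ) : ℝ)| ≤ D := fun m => by
    rcases hd m with h | h
    · rw [h]
      simpa using (abs_nonneg _).trans (hs m)
    · rw [h.2]
      simpa using hs m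
  obtain ⟨z, hz⟩ := hL _ hdD n fun m h1 h2 =>
    (hd m).resolve_right fun h => hn' ⟨m, h.1, h1, h2⟩
  refine ⟨z, ?_⟩
  rwa [hsum, sub_mul] at hz

/-- If `y i < K` for infinitely many `i`, such blocks end in `l` zero digits, with `l` about `2 ^ i
/ K` or more. Apart from `L` places at each end of this run, the orbit is within `1/4` of an
integer. Visits to `[-1/4, 1/4)` then increase by almost `l` over the run, where uniform
distribution predicts about `l / 2`. -/
theorem tendsto_atTop_of_isUniformlyDistributedModOne_eraseTails {α D : ℝ} (hα : IsPisot |α|)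
    {s : ℕ → ℤ} (hs : ∀ m, |(s m : ℝ)| ≤ D) {y : ℕ → ℕ}
    (hu : IsUniformlyDistributedModOne
      fun n => (∑' m, (eraseTails s y m : ℝ) * α⁻¹ ^ m) * α ^ n) :
    Tendsto y atTop atTop := by
  by_contra hy
  rw [tendsto_atTop] at hy
  push Not at hy
  obtain ⟨K, hK⟩ := hy
  obtain ⟨L, hL⟩ := exists_abs_tsum_mul_pow_sub_lt hα (D := D) (show (0 : ℝ) < 1 / 4 by norm_num)
  rw [isUniformlyDistributedModOne_iff] at hu
  have hc := hu (-1 / 4) (1 / 4) (by norm_num) (by norm_num) (by norm_num)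
  set A : Set ℕ := {n | centeredFract ((∑' m, (eraseTails s y m : ℝ) * α⁻¹ ^ m) * α ^ n) ∈
    Set.Ico (-1 / 4 : ℝ) (1 / 4)} with hA
  have hK0 : (0 : ℝ) < K := by
    obtain ⟨i, hi⟩ := hK.exists
    exact_mod_cast Nat.zero_lt_of_lt hi
  -- The errors at the two ends of the run then total at most `2 ^ i / (4 * K)`, below the excess `l
  -- / 2`, which is about `2 ^ i / (2 * K)` or more.
  have hδ : (0 : ℝ) < 1 / (16 * K) := by positivity
  obtain ⟨M, hM⟩ := eventually_atTop.1 ((Metric.tendsto_nhds.1 hc _ hδ).and (eventually_gt_atTop 0))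
  have hMc : ∀ N ≥ M, |(countBelow A N : ℝ) - N / 2| ≤ 1 / (16 * K) * N := fun N hN => by
    obtain ⟨h1, h2⟩ := hM N hN
    have hN0 : (0 : ℝ) < N := by exact_mod_cast h2
    rw [Real.dist_eq] at h1
    have h3 : (countBelow A N : ℝ) - N / 2 = ((countBelow A N : ℝ) / N - (1 / 4 - -1 / 4)) * N := by
      field_simp
      ring
    rw [h3, abs_mul, abs_of_pos hN0]
    exact mul_le_mul_of_nonneg_right h1.le hN0.le
  -- This absorbs the `2 * L` boundary places and the rounding in `l`.
  have hpow : ∀ᶠ i : ℕ in atTop, 4 * (K : ℝ) * (2 * L + 1) < 2 ^ i :=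
    (tendsto_pow_atTop_atTop_of_one_lt one_lt_two).eventually_gt_atTop _
  obtain ⟨i, hi, hi2, hiM⟩ := (hK.and_eventually (hpow.and (eventually_ge_atTop M))).exists
  obtain ⟨l, hl⟩ : ∃ l, l = 2 ^ i / (y i + 1) := ⟨_, rfl⟩
  have hl1 : l ≤ 2 ^ i := hl ▸ Nat.div_le_self _ _
  have h2i : 2 ^ (i + 1) = 2 ^ i + 2 ^ i := by ring
  have hi3 : i < 2 ^ i := Nat.lt_two_pow_self
  have hmemA : ∀ n, 2 ^ (i + 1) - l + L ≤ n → n < 2 ^ (i + 1) - L → n ∈ A := by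
    intro n h1 h2
    obtain ⟨z, hz⟩ := hL (eraseTails s y) (abs_eraseTails_le hs y) n fun m h3 h4 => by
      have : m ∈ dyadicTails y := mem_dyadicTails (i := i) (by omega) (by omega)
      simp [eraseTails, this]
    rw [abs_lt] at hz
    rw [hA, Set.mem_ofPred_eq, centeredFract_eq_sub_intCast (m := z) (by linarith) (by linarith)]
    exact ⟨by linarith, hz.2⟩
  have hcount := countBelow_add_le_of_Ico_subset (A := A) (M := 2 ^ (i + 1) - l) (N := 2 ^ (i + 1))
    (Nat.sub_le _ _) (Nat.le_add_right _ _) (Nat.sub_le _ _) hmemA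
  have hcount' : countBelow A (2 ^ (i + 1) - l) + l ≤ countBelow A (2 ^ (i + 1)) + 2 * L := by omega
  have hcR : (countBelow A (2 ^ (i + 1) - l) : ℝ) + l ≤ countBelow A (2 ^ (i + 1)) + 2 * L := by
    exact_mod_cast hcount'
  have hb0 := (abs_le.1 (hMc (2 ^ (i + 1) - l) (by omega))).1
  have hb1 := (abs_le.1 (hMc (2 ^ (i + 1)) (by omega))).2
  have hcast : ((2 ^ (i + 1) - l : ℕ) : ℝ) = 2 * 2 ^ i - l := by
    rw [Nat.cast_sub (by omega)]
    push_cast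
    ring
  have hcast' : ((2 ^ (i + 1) : ℕ) : ℝ) = 2 * 2 ^ i := by
    push_cast
    ring
  rw [hcast] at hb0
  rw [hcast'] at hb1
  have hl2 : 2 ^ i < (l + 1) * K := by
    have h1 : 2 ^ i < (y i + 1) * (l + 1) := hl ▸ Nat.lt_mul_div_succ _ (Nat.succ_pos _)
    have h2 : (y i + 1) * (l + 1) ≤ K * (l + 1) := Nat.mul_le_mul_right _ hi
    rw [mul_comm _ K]
    exact h1.trans_le h2
  have hl2R : (2 : ℝ) ^ i < (l + 1) * K := by exact_mod_cast hl2
  have hlR : (0 : ℝ) ≤ l := Nat.cast_nonneg l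
  have hd : 1 / (16 * (K : ℝ)) * (4 * 2 ^ i) * (4 * K) = 2 ^ i := by
    field_simp
    norm_num
  have h3 : (l : ℝ) / 2 ≤ 2 * L + 1 / (16 * (K : ℝ)) * (4 * 2 ^ i) := by
    have h4 : 0 ≤ 1 / (16 * (K : ℝ)) * l := by positivity
    linarith
  have h5 : (l : ℝ) / 2 * (4 * K) ≤ 2 * L * (4 * K) + 2 ^ i := by
    have := mul_le_mul_of_nonneg_right h3 (show (0 : ℝ) ≤ 4 * K by positivity)
    rwa [add_mul, hd] at this
  linarith

/-- The set of sequences tending to infinity is a continuous preimage of the set of normal numbers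
in a base whose absolute value is a Pisot number. -/
theorem exists_continuous_mem_normalNumbers_iff {α : ℝ} (hα : IsPisot |α|) :
    ∃ f : (ℕ → ℕ) → ℝ, Continuous f ∧ ∀ y, f y ∈ normalNumbers α ↔ Tendsto y atTop atTop := by
  obtain ⟨ξ, hξu⟩ := exists_hasArcBounds hα.1
  obtain ⟨s, D, hs, hξ⟩ := exists_hasSum_intCast_mul_inv_pow hα.1 ξ
  exact ⟨_, continuous_tsum_eraseTails hα.1 hs, fun y =>
    ⟨fun h => tendsto_atTop_of_isUniformlyDistributedModOne_eraseTails hα hs h,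
      fun h => isUniformlyDistributedModOne_eraseTails hα hs hξ hξu h⟩⟩

theorem mainTheorem2 (α : ℝ) (hα : IsPisot |α|) :
    (∀ k : ℕ,
      IsPi0Complete 3
        {ξ : Fin (k + 1) → ℝ |
          IsUniformlyDistributedModOne
            (fun n : ℕ => ∑ j : Fin (k + 1), ξ j * (n : ℝ) ^ (j : ℕ) * α ^ n)}) ∧
      IsPi0Complete 3 (normalNumbers α) := by
  obtain ⟨f, hf, hfm⟩ := exists_continuous_mem_normalNumbers_iff hα
  refine ⟨fun k => ⟨isPi0_three_setOf_isUniformlyDistributedModOne fun n => by fun_prop, ?_⟩,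
    isPi0_three_setOf_isUniformlyDistributedModOne fun n => by fun_prop,
    not_isSigma0_three_of_continuous hf hfm⟩
  -- With the other coefficients zero, the sum collapses to `f y * α ^ n`, at `n = 0` too because `0
  -- ^ 0 = 1`.
  have hc : Continuous fun y => (Pi.single 0 (f y) : Fin (k + 1) → ℝ) :=
    (continuous_single (A := fun _ : Fin (k + 1) => ℝ) 0).comp hf
  refine not_isSigma0_three_of_continuous hc fun y => ?_
  rw [← hfm y, normalNumbers, Set.mem_ofPred_eq, Set.mem_ofPred_eq]
  simp [Fin.sum_univ_succ]
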